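/- A \emph{$\lambda$-graph} is a finite simple directed graph (no loops, no parallel edges) in which every edge $e$ has a weight $\lambda\cdot m_e+b_e$ with real numbers $m_e\ge 0$ and $b_e$. Let $\lambda^*$ be the smallest real value of $\lambda$ for which the graph has no directed cycle of negative weight; put $\lambda^*=-\infty$ if no real value of $\lambda$ yields a negative cycle and $\lambda^*=+\infty$ if every real value does. Consider the following algorithm, whose input is a $\lambda$-graph with vertex set $V$, $|V|=n$, given by its adjacency matrix. Set $\lambda_1=-\infty$, $\lambda_2=+\infty$, and let $D_0(u,v)$ be $0$ if $u=v$, $\lambda\cdot m_e+b_e$ if there is an edge $e$ from $u$ to $v$, and $+\infty$ otherwise. For $i=1,\dots,\lceil\log_2 n\rceil$: 1. compute for all $u,v\in V$ the piecewise linear function $D_i(u,v)=\min_{w\in V}[D_{i-1}(u,w)+D_{i-1}(w,v)]$ (sort the linear functions by slope with merge sort, then build their lower envelope with a stack); 2. collect the set $B$ of all breakpoints of the functions $D_i(u,v)$ strictly between $\lambda_1$ and $\lambda_2$, and sort it (merge sort); 3. by binary search in $B$ find the interval between consecutive elements of $B\cup\{\lambda_1,\lambda_2\}$ that contains $\lambda^*$,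 where a test value counts as less than $\lambda^*$ exactly if the Bellman--Ford algorithm finds a negative cycle at that value; let $\lambda_1,\lambda_2$ be the endpoints of this interval; 4. replace every $D_i(u,v)$ by the linear function (or $+\infty$) with which it agrees on $[\lambda_1,\lambda_2]$. Finally, with $k=\lceil\log_2 n\rceil$, return the smallest value in $[\lambda_1,\lambda_2]$ for which $D_k(v,v)\ge 0$ for all $v\in V$ (it is $+\infty$ if no real value qualifies). \textbf{Theorem.} For every $\lambda$-graph the algorithm returns $\lambda^*$; in particular, if some real value of $\lambda$ yields a negative cycle and some other does not, then the smallest value without negative cycles exists. On a real RAM (unit cost for each arithmetic operation and comparison of real numbers, each memory access, each loop or recursion step, and each elementary list operation) it runs in time $O(n^3\log^2 n)$: there is a constant $C$ such that for all $n\ge 2$ and every $\lambda$-graph with $n$ vertices it makes at most $C\,n^3(\log n)^2$ steps. -/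

import Mathlib

/-! ### Lines, extended values, parametrically weighted graphs -/

/-- A linear function `t ↦ slope * t + icept` with coefficients in `R`. -/
structure Line (R : Type) where
  slope : R
  icept : R

/-- The extended values `-∞`, `x`, `+∞`. -/
inductive ExtVal (R : Type) : Type
  | negInf : ExtVal R
  | fin : R → ExtVal R
  | posInf : ExtVal R

/-- The value of a line at `t`. -/
def Line.eval (l : Line ℝ) (t : ℝ) : ℝ := t * l.slope + l.icept

/-- A `λ`-graph on the vertices `0, …, n-1`: a simple directed graph, given by its adjacency
matrix (`none`: no edge), each edge `e` of which carries a weight `λ * m_e + b_e` with `0 ≤ m_e`.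
Connectedness is not required. -/
structure LambdaGraph (n : ℕ) where
  edge : Fin n → Fin n → Option (Line ℝ)
  loopless : ∀ v, edge v v = none
  slope_nonneg : ∀ u v l, edge u v = some l → 0 ≤ l.slope

/-- For the parameter value `t`, the graph has a (simple, directed) cycle
`c 0 → c 1 → … → c k → c 0` of negative weight. The addition in `Fin (k + 1)` is cyclic;
`l i` is the weight function of the edge that leaves `c i`. -/
def LambdaGraph.HasNegCycle {n : ℕ} (G : LambdaGraph n) (t : ℝ) : Prop :=
  ∃ (k : ℕ) (c : Fin (k + 1) → Fin n) (l : Fin (k + 1) → Line ℝ),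
    Function.Injective c ∧ (∀ i, G.edge (c i) (c (i + 1)) = some (l i)) ∧
      ∑ i, (l i).eval t < 0

/-- `x` is `λ*`, the smallest parameter value without negative cycles; it is `-∞` if no parameter
value has a negative cycle, and `+∞` if every parameter value has one. -/
def LambdaGraph.IsLambdaStar {n : ℕ} (G : LambdaGraph n) : ExtVal ℝ → Prop
  | .negInf => ∀ t : ℝ, ¬ G.HasNegCycle t
  | .fin x => IsLeast {t : ℝ | ¬ G.HasNegCycle t} x
  | .posInf => ∀ t : ℝ, G.HasNegCycle t

/-! ### The real RAM

Programs are polymorphic in the type `R` of the numbers that they handle, so that they have no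
access to these numbers except by the instructions below, each of which takes one unit of time. -/

inductive ArithOp : Type
  | add | sub | mul | div

/-- A computation with result in `α`. The instructions are: load the constant `0`; an arithmetic
operation; a comparison `x < y`; and `step`, which is the charge for every other elementary
operation (a read or a write of a memory cell, a loop or recursion step with its counter, a list
operation on the head of a list). -/
inductive RealRAM (R : Type) (α : Type) : Type
  | done (a : α) : RealRAM R α
  | zero (k : R → RealRAM R α) : RealRAM R α
  | arith (o : ArithOp) (x y : R) (k : R → RealRAM R α) : RealRAM R α
  | less (x y : R) (k : Bool → RealRAM R α) : RealRAM R α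
  | step (k : RealRAM R α) : RealRAM R α

namespace RealRAM

variable {R α β σ : Type}

/-- Sequential composition. -/
def andThen : RealRAM R α → (α → RealRAM R β) → RealRAM R β
  | done a, f => f a
  | zero k, f => zero fun z => andThen (k z) f
  | arith o x y k, f => arith o x y fun z => andThen (k z) f
  | less x y k, f => less x y fun b => andThen (k b) f
  | step k, f => step (andThen k f)

instance : Monad (RealRAM R) where
  pure := done
  bind := andThen

/-- The effect of an arithmetic instruction. -/
def opValue [Field R] : ArithOp → R → R → R
  | .add, x, y => x + y
  | .sub, x, y => x - y
  | .mul, x, y => x * y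
  | .div, x, y => x / y

/-- The result of a computation. -/
def value [Field R] [LinearOrder R] : RealRAM R α → α
  | done a => a
  | zero k => value (k 0)
  | arith o x y k => value (k (opValue o x y))
  | less x y k => value (k (decide (x < y)))
  | step k => value k

/-- The running time of a computation: the number of instructions executed. -/
def cost [Field R] [LinearOrder R] : RealRAM R α → ℕ
  | done _ => 0
  | zero k => cost (k 0) + 1
  | arith o x y k => cost (k (opValue o x y)) + 1
  | less x y k => cost (k (decide (x < y))) + 1
  | step k => cost k + 1

def zeroM : RealRAM R R := zero done
def addM (x y : R) : RealRAM R R := arith .add x y done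
def subM (x y : R) : RealRAM R R := arith .sub x y done
def mulM (x y : R) : RealRAM R R := arith .mul x y done
def divM (x y : R) : RealRAM R R := arith .div x y done
def ltM (x y : R) : RealRAM R Bool := less x y done
def stepM : RealRAM R Unit := step (done ())

/-- `k` elementary steps. -/
def stepsM : ℕ → RealRAM R Unit
  | 0 => done ()
  | k + 1 => step (stepsM k)

/-- Comparison `x < y` of extended values. -/
def extLtM : ExtVal R → ExtVal R → RealRAM R Bool
  | .negInf, .negInf => do stepM; return false
  | .negInf, _ => do stepM; return true
  | .fin x, .fin y => do stepM; ltM x y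
  | .fin _, .posInf => do stepM; return true
  | _, _ => do stepM; return false

/-- Read a cell of an array. -/
def readM {n : ℕ} (T : Fin n → α) (i : Fin n) : RealRAM R α := step (done (T i))

/-- Read a cell of a square matrix. -/
def readM₂ {n : ℕ} (T : Fin n → Fin n → α) (i j : Fin n) : RealRAM R α := step (done (T i j))

/-- Fill an array, computing its entries one after the other. -/
def tabulate : (n : ℕ) → (Fin n → RealRAM R α) → RealRAM R (Fin n → α)
  | 0, _ => done Fin.elim0
  | n + 1, f => do
      let a ← f 0
      stepM
      let T ← tabulate n fun i => f i.succ
      return Fin.cons a T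

/-- Fill an `n × n` matrix. -/
def tabulate₂ (n : ℕ) (f : Fin n → Fin n → RealRAM R α) : RealRAM R (Fin n → Fin n → α) :=
  tabulate n fun i => tabulate n fun j => f i j

/-- A loop over the elements of a list, which updates a state. -/
def loop (f : σ → α → RealRAM R σ) : σ → List α → RealRAM R σ
  | s, [] => done s
  | s, a :: l => do
      stepM
      let s' ← f s a
      loop f s' l

/-- A loop that is executed `k` times. -/
def iter (f : σ → RealRAM R σ) : ℕ → σ → RealRAM R σ
  | 0, s => done s
  | k + 1, s => do
      stepM
      let s' ← f s
      iter f k s'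

/-- Merge two sorted lists. -/
def mergeM (le : α → α → RealRAM R Bool) : List α → List α → RealRAM R (List α)
  | [], ys => do stepM; return ys
  | xs, [] => do stepM; return xs
  | x :: xs, y :: ys => do
      stepM
      if ← le x y then
        let zs ← mergeM le xs (y :: ys)
        return x :: zs
      else
        let zs ← mergeM le (x :: xs) ys
        return y :: zs
termination_by xs ys => xs.length + ys.length

/-- Merge sort; splitting a list is charged with its length. -/
def sortM (le : α → α → RealRAM R Bool) : List α → RealRAM R (List α)
  | [] => do stepM; return []
  | [x] => do stepM; return [x]
  | x :: y :: l => do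
      stepsM (x :: y :: l).length
      let xs ← sortM le ((x :: y :: l).take (((x :: y :: l).length + 1) / 2))
      let ys ← sortM le ((x :: y :: l).drop (((x :: y :: l).length + 1) / 2))
      mergeM le xs ys
termination_by l => l.length
decreasing_by
  · simp only [List.length_take, List.length_cons]; omega
  · simp only [List.length_drop, List.length_cons]; omega

end RealRAM

/-! ### The algorithm -/

namespace LambdaStar

open RealRAM

variable {R : Type}

/-- A piece of a piecewise linear function: a line, and the point from which on it is valid. -/
structure Piece (R : Type) where
  start : ExtVal R
  line : Line R

/-- A concave piecewise linear function, from its rightmost piece to its leftmost one, which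
starts at `-∞`. The empty list stands for the constant `+∞`. -/
abbrev PLFun (R : Type) := List (Piece R)

/-- The order in which lines enter a lower envelope: by decreasing slope, then by increasing
intercept. -/
def lineLeM (a b : Line R) : RealRAM R Bool := do
  if ← ltM b.slope a.slope then
    return true
  else if ← ltM a.slope b.slope then
    return false
  else
    let r ← ltM b.icept a.icept
    return !r

/-- Replace the lower envelope of some lines by its minimum with the line `l`, which comes after
these lines in the above order. -/
def pushLine (l : Line R) : PLFun R → RealRAM R (PLFun R)
  | [] => do stepM; return [⟨.negInf, l⟩]
  | p :: ps => do
      stepM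
      if ← ltM l.slope p.line.slope then
        let db ← subM l.icept p.line.icept
        let dm ← subM p.line.slope l.slope
        let x ← divM db dm
        if ← extLtM p.start (.fin x) then
          return ⟨.fin x, l⟩ :: p :: ps
        else
          pushLine l ps
      else
        return p :: ps

/-- The minimum of finitely many linear functions, as a piecewise linear function. -/
def lowerEnvelope (ls : List (Line R)) : RealRAM R (PLFun R) := do
  let sorted ← sortM lineLeM ls
  loop (fun ps l => pushLine l ps) [] sorted

/-- The initial matrix `D₀`: `0` on the diagonal, the weight of the edge from `u` to `v` if there
is one, and `+∞` (`none`) otherwise. -/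
def initialMatrix {n : ℕ} (edge : Fin n → Fin n → Option (Line R)) :
    RealRAM R (Fin n → Fin n → Option (Line R)) :=
  tabulate₂ n fun u v => do
    stepM
    if u = v then
      let z ← zeroM
      return some ⟨z, z⟩
    else
      readM₂ edge u v

/-- The entry `min_w [D(u,w) + D(w,v)]`. -/
def minPlusEntry {n : ℕ} (D : Fin n → Fin n → Option (Line R)) (u v : Fin n) :
    RealRAM R (PLFun R) := do
  let ls ← loop (fun (acc : List (Line R)) w => do
      match ← readM₂ D u w, ← readM₂ D w v with
      | some a, some b =>
        let m ← addM a.slope b.slope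
        let c ← addM a.icept b.icept
        return ⟨m, c⟩ :: acc
      | _, _ => return acc) [] (List.finRange n)
  lowerEnvelope ls

/-- Remove repetitions from a sorted list. -/
def dedupSorted : List R → RealRAM R (List R)
  | [] => do stepM; return []
  | [x] => do stepM; return [x]
  | x :: y :: l => do
      stepM
      let r ← dedupSorted (y :: l)
      if ← ltM x y then
        return x :: r
      else
        return r

/-- The sorted list of the breakpoints, strictly between `lo` and `hi`, of the entries of `E`. -/
def breakpoints {n : ℕ} (E : Fin n → Fin n → PLFun R) (lo hi : ExtVal R) :
    RealRAM R (List R) := do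
  let B ← loop (fun B u =>
    loop (fun B v => do
      let ps ← readM₂ E u v
      loop (fun (B : List R) p =>
        match p.start with
        | .fin x => do
          if ← extLtM lo (.fin x) then
            if ← extLtM (.fin x) hi then
              return x :: B
            else return B
          else return B
        | _ => return B) B ps) B (List.finRange n)) [] (List.finRange n)
  let S ← sortM (fun x y => do let r ← ltM y x; return !r) B
  dedupSorted S

/-- Bellman–Ford with an additional source that is joined to every vertex by an edge of weight
`0`: does the graph have a negative cycle for the parameter value `t`? After `n` rounds of
relaxations there is one if and only if some edge can still be relaxed. -/
def bellmanFord {n : ℕ} (edge : Fin n → Fin n → Option (Line R)) (t : R) : RealRAM R Bool := do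
  let W ← tabulate₂ n fun u v => do
    match ← readM₂ edge u v with
    | some l =>
      let x ← mulM t l.slope
      let y ← addM x l.icept
      return some y
    | none => return none
  let d₀ ← tabulate n fun _ => zeroM
  let d ← iter (fun d => tabulate n fun v => do
      let dv ← readM d v
      loop (fun (best : R) u => do
        match ← readM₂ W u v with
        | some w =>
          let du ← readM d u
          let x ← addM du w
          if ← ltM x best then return x else return best
        | none => return best) dv (List.finRange n)) n d₀
  loop (fun found u =>
    loop (fun (found : Bool) v => do
      match ← readM₂ W u v with
      | some w =>
        let du ← readM d u
        let x ← addM du w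
        let dv ← readM d v
        if ← ltM x dv then return true else return found
      | none => return found) found (List.finRange n)) false (List.finRange n)

/-- Binary search among the sorted breakpoints `B`, which lie between `lo` and `hi`, for the
interval between consecutive ones that contains `λ*`: a test value is less than `λ*` if and only
if Bellman–Ford finds a negative cycle for it. Taking a list apart is charged with its length. -/
def binarySearch {n : ℕ} (edge : Fin n → Fin n → Option (Line R)) (lo hi : ExtVal R) :
    List R → RealRAM R (ExtVal R × ExtVal R)
  | [] => do stepM; return (lo, hi)
  | x :: B => do
      stepsM (x :: B).length
      let test := (x :: B).get ⟨(x :: B).length / 2, by simp only [List.length_cons]; omega⟩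
      if ← bellmanFord edge test then
        binarySearch edge (.fin test) hi ((x :: B).drop ((x :: B).length / 2 + 1))
      else
        binarySearch edge lo (.fin test) ((x :: B).take ((x :: B).length / 2))
termination_by B => B.length
decreasing_by
  · simp only [List.length_drop, List.length_cons]; omega
  · simp only [List.length_take, List.length_cons]; omega

/-- The line that represents a piecewise linear function to the right of `lo`, up to its next
breakpoint. -/
def simplify (lo : ExtVal R) : PLFun R → RealRAM R (Option (Line R))
  | [] => do stepM; return none
  | p :: ps => do
      stepM
      if ← extLtM lo p.start then
        simplify lo ps
      else
        return some p.line

/-- The variables `λ₁`, `λ₂`, `D` of the algorithm. -/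
structure Vars (R : Type) (n : ℕ) where
  lo : ExtVal R
  hi : ExtVal R
  D : Fin n → Fin n → Option (Line R)

/-- One iteration of the main loop. -/
def round {n : ℕ} (edge : Fin n → Fin n → Option (Line R)) (s : Vars R n) :
    RealRAM R (Vars R n) := do
  let E ← tabulate₂ n fun u v => minPlusEntry s.D u v
  let B ← breakpoints E s.lo s.hi
  let I ← binarySearch edge s.lo s.hi B
  let D ← tabulate₂ n fun u v => do
    let ps ← readM₂ E u v
    simplify I.1 ps
  return ⟨I.1, I.2, D⟩

/-- The smallest value from `lo` on for which all diagonal entries of `D` are nonnegative, if these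
are nondecreasing linear functions. -/
def finalValue {n : ℕ} (lo : ExtVal R) (D : Fin n → Fin n → Option (Line R)) :
    RealRAM R (ExtVal R) := do
  let z ← zeroM
  loop (fun (best : ExtVal R) v => do
    match ← readM₂ D v v with
    | some l =>
      if ← ltM z l.slope then
        let b ← subM z l.icept
        let x ← divM b l.slope
        if ← extLtM best (.fin x) then return .fin x else return best
      else if ← ltM l.icept z then
        return .posInf
      else
        return best
    | none => return best) lo (List.finRange n)

/-- The algorithm: from the edges of a `λ`-graph with `n` vertices, compute `λ*`. -/
def algorithm {n : ℕ} (edge : Fin n → Fin n → Option (Line R)) : RealRAM R (ExtVal R) := do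
  let D₀ ← initialMatrix edge
  let s ← iter (round edge) (Nat.clog 2 n) ⟨.negInf, .posInf, D₀⟩
  finalValue s.lo s.D

end LambdaStar

/-!
Correctness. For a fixed parameter value `t`, the iterated min-plus square `D_i(t)` of the matrix of
edge weights (with zeros on the diagonal) contains the minimum weights of the walks with at most
`2 ^ i` edges. A simple cycle has at most `n ≤ 2 ^ k` edges, and a negative closed walk contains a
negative simple cycle; hence `t` has a negative cycle if and only if `D_k(t)` has a negative
diagonal entry (`LambdaGraph.hasNegCycle_iff_iterate_minPlusSq`). Since all slopes are nonnegative,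
having a negative cycle is monotone in `t`, so a binary search with Bellman–Ford as its test
(`LambdaStar.value_bellmanFord`) brackets `λ*` between consecutive breakpoints. In this bracket no
entry has a breakpoint, and one line per entry represents `D_i`: this is the loop invariant
`LambdaStar.LoopInvariant`. After the last round the diagonal entries are nondecreasing lines, and
the returned value `r` satisfies `r ≤ t ↔ ¬ HasNegCycle t` for every real `t`
(`LambdaStar.toEReal_value_algorithm_le_iff`), which characterizes `λ*`, infinite cases included.

Running time. With `k = ⌈log₂ n⌉`, a round costs `O(n ^ 3 * k)`: each of the `n ^ 2` lower envelopes
is built in `O(n * k)` steps, because removing a piece is paid for when the piece is pushed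
(`LambdaStar.cost_pushLine_add_le`); an envelope of `n` lines has at most `n` pieces, so that at
most `n ^ 3` breakpoints are sorted; and the binary search makes `O(k)` calls of Bellman–Ford, each
of which costs `O(n ^ 3)`. There are `k` rounds.
-/

/-! ### Results and running times of programs -/

namespace RealRAM

variable {R α β σ : Type} [Field R] [LinearOrder R]

@[simp] theorem value_bind (x : RealRAM R α) (f : α → RealRAM R β) :
    (x >>= f).value = (f x.value).value := by
  change (andThen x f).value = _
  induction x with
  | done a => rfl
  | zero k ih => exact ih _
  | arith o x y k ih => exact ih _
  | less x y k ih => exact ih _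
  | step k ih => exact ih

@[simp] theorem cost_bind (x : RealRAM R α) (f : α → RealRAM R β) :
    (x >>= f).cost = x.cost + (f x.value).cost := by
  change (andThen x f).cost = _
  induction x with
  | done a => simp [andThen, cost, value]
  | zero k ih => simp only [andThen, cost, value, ih]; omega
  | arith o x y k ih => simp only [andThen, cost, value, ih]; omega
  | less x y k ih => simp only [andThen, cost, value, ih]; omega
  | step k ih => simp only [andThen, cost, value, ih]; omega

theorem value_ite (p : Prop) [Decidable p] (x y : RealRAM R α) :
    (if p then x else y).value = if p then x.value else y.value := apply_ite _ _ _ _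

theorem cost_ite (p : Prop) [Decidable p] (x y : RealRAM R α) :
    (if p then x else y).cost = if p then x.cost else y.cost := apply_ite _ _ _ _

@[simp] theorem value_pure (a : α) : (pure a : RealRAM R α).value = a := rfl
@[simp] theorem cost_pure (a : α) : (pure a : RealRAM R α).cost = 0 := rfl
@[simp] theorem value_done (a : α) : (done a : RealRAM R α).value = a := rfl
@[simp] theorem cost_done (a : α) : (done a : RealRAM R α).cost = 0 := rfl
@[simp] theorem value_zeroM : (zeroM : RealRAM R R).value = 0 := rfl
@[simp] theorem cost_zeroM : (zeroM : RealRAM R R).cost = 1 := rfl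
@[simp] theorem value_addM (x y : R) : (addM x y).value = x + y := rfl
@[simp] theorem cost_addM (x y : R) : (addM x y).cost = 1 := rfl
@[simp] theorem value_subM (x y : R) : (subM x y).value = x - y := rfl
@[simp] theorem cost_subM (x y : R) : (subM x y).cost = 1 := rfl
@[simp] theorem value_mulM (x y : R) : (mulM x y).value = x * y := rfl
@[simp] theorem cost_mulM (x y : R) : (mulM x y).cost = 1 := rfl
@[simp] theorem value_divM (x y : R) : (divM x y).value = x / y := rfl
@[simp] theorem cost_divM (x y : R) : (divM x y).cost = 1 := rfl
@[simp] theorem value_ltM (x y : R) : (ltM x y).value = decide (x < y) := rfl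
@[simp] theorem cost_ltM (x y : R) : (ltM x y).cost = 1 := rfl
@[simp] theorem cost_stepM : (stepM : RealRAM R Unit).cost = 1 := rfl

@[simp] theorem cost_stepsM (k : ℕ) : (stepsM k : RealRAM R Unit).cost = k := by
  induction k with
  | zero => rfl
  | succ k ih => simp [stepsM, cost, ih]

@[simp] theorem value_readM {n : ℕ} (T : Fin n → α) (i : Fin n) :
    (readM T i : RealRAM R α).value = T i := rfl
@[simp] theorem cost_readM {n : ℕ} (T : Fin n → α) (i : Fin n) :
    (readM T i : RealRAM R α).cost = 1 := rfl
@[simp] theorem value_readM₂ {n : ℕ} (T : Fin n → Fin n → α) (i j : Fin n) :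
    (readM₂ T i j : RealRAM R α).value = T i j := rfl
@[simp] theorem cost_readM₂ {n : ℕ} (T : Fin n → Fin n → α) (i j : Fin n) :
    (readM₂ T i j : RealRAM R α).cost = 1 := rfl

theorem cost_extLtM_le (a b : ExtVal R) : (extLtM a b).cost ≤ 2 := by
  cases a <;> cases b <;> simp [extLtM]

@[simp] theorem value_tabulate (n : ℕ) (f : Fin n → RealRAM R α) :
    (tabulate n f).value = fun i => (f i).value := by
  induction n with
  | zero => funext i; exact i.elim0
  | succ n ih =>
    funext i
    refine Fin.cases ?_ (fun i => ?_) i <;> simp [tabulate, ih]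

theorem cost_tabulate_le (n : ℕ) (f : Fin n → RealRAM R α) (c : ℕ) (h : ∀ i, (f i).cost ≤ c) :
    (tabulate n f).cost ≤ n * (c + 1) := by
  induction n with
  | zero => simp [tabulate]
  | succ n ih =>
    have h₀ := h 0
    have h₁ := ih (fun i => f i.succ) fun i => h _
    simp only [tabulate, cost_bind, cost_stepM, cost_pure]
    linarith

@[simp] theorem value_tabulate₂ (n : ℕ) (f : Fin n → Fin n → RealRAM R α) :
    (tabulate₂ n f).value = fun i j => (f i j).value := by
  simp [tabulate₂]

theorem cost_tabulate₂_le (n : ℕ) (f : Fin n → Fin n → RealRAM R α) (c : ℕ)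
    (h : ∀ i j, (f i j).cost ≤ c) : (tabulate₂ n f).cost ≤ n * (n * (c + 1) + 1) :=
  cost_tabulate_le n _ _ fun i => cost_tabulate_le n _ _ (h i)

/-- A property `Q` of the state of a loop that is turned, by each list element `a`, into the
conjunction of `Q` with a property `P a`. All loops of the algorithm that compute minima, maxima,
sets, or search results are analysed by a suitable choice of `Q`. -/
theorem value_loop_iff (f : σ → α → RealRAM R σ) (Q : σ → Prop) (P : α → Prop)
    (h : ∀ s a, Q (f s a).value ↔ Q s ∧ P a) (s : σ) (l : List α) :
    Q (loop f s l).value ↔ Q s ∧ ∀ a ∈ l, P a := by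
  induction l generalizing s with
  | nil => simp [loop]
  | cons a l ih => simp [loop, ih, h, and_assoc]

/-- Amortized analysis of a loop with the potential function `Φ`. -/
theorem cost_loop_add_le (f : σ → α → RealRAM R σ) (Φ : σ → ℕ) (c : ℕ) (l : List α)
    (h : ∀ s, ∀ a ∈ l, (f s a).cost + Φ (f s a).value ≤ c + Φ s) (s : σ) :
    (loop f s l).cost + Φ (loop f s l).value ≤ l.length * (c + 1) + Φ s := by
  induction l generalizing s with
  | nil => simp [loop]
  | cons a l ih =>
    have h₀ := h s a (by simp)
    have h₁ := ih (fun s b hb => h s b (by simp [hb])) (f s a).value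
    simp only [loop, cost_bind, cost_stepM, value_bind, List.length_cons]
    linarith

theorem cost_loop_le (f : σ → α → RealRAM R σ) (c : ℕ) (l : List α)
    (h : ∀ s, ∀ a ∈ l, (f s a).cost ≤ c) (s : σ) : (loop f s l).cost ≤ l.length * (c + 1) := by
  simpa using cost_loop_add_le f (fun _ => 0) c l (by simpa using h) s

theorem length_value_loop_le (f : List β → α → RealRAM R (List β)) (c : ℕ) (l : List α)
    (h : ∀ s, ∀ a ∈ l, (f s a).value.length ≤ c + s.length) (s : List β) :
    (loop f s l).value.length ≤ l.length * c + s.length := by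
  induction l generalizing s with
  | nil => simp [loop]
  | cons a l ih =>
    have h₀ := h s a (by simp)
    have h₁ := ih (fun s b hb => h s b (by simp [hb])) (f s a).value
    simp only [loop, value_bind, List.length_cons]
    linarith

/-- An invariant of an iterated procedure, indexed by the number of rounds done. -/
theorem value_iter_induct (f : σ → RealRAM R σ) (P : ℕ → σ → Prop)
    (h : ∀ i s, P i s → P (i + 1) (f s).value) (k : ℕ) (s : σ) (hs : P 0 s) :
    P k (iter f k s).value := by
  induction k generalizing P s with
  | zero => exact hs
  | succ k ih =>
    simpa [iter] using ih (fun i => P (i + 1)) (fun i => h (i + 1)) (f s).value (h 0 s hs)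

theorem cost_iter_le (f : σ → RealRAM R σ) (c : ℕ) (h : ∀ s, (f s).cost ≤ c) (k : ℕ) (s : σ) :
    (iter f k s).cost ≤ k * (c + 1) := by
  induction k generalizing s with
  | zero => simp [iter]
  | succ k ih =>
    have h₀ := h s
    have h₁ := ih (f s).value
    simp only [iter, cost_bind, cost_stepM]
    linarith

/-! ### Merge sort -/

theorem value_mergeM (le : α → α → RealRAM R Bool) (xs ys : List α) :
    (mergeM le xs ys).value = List.merge xs ys fun a b => (le a b).value := by
  fun_induction mergeM le xs ys with
  | case1 ys => simp
  | case2 xs h => simp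
  | case3 x xs y ys ih₁ ih₂ =>
    simp only [value_bind, List.merge]
    split <;> simp [ih₁, ih₂]

theorem cost_mergeM_le (le : α → α → RealRAM R Bool) (c : ℕ) (h : ∀ a b, (le a b).cost ≤ c)
    (xs ys : List α) :
    (mergeM le xs ys).cost ≤ (c + 1) * (xs.length + ys.length) + 1 := by
  fun_induction mergeM le xs ys with
  | case1 ys => simp
  | case2 xs h => simp
  | case3 x xs y ys ih₁ ih₂ =>
    have h₀ := h x y
    simp only [cost_bind, cost_stepM]
    simp only [List.length_cons] at ih₁ ih₂ ⊢
    split <;> simp only [cost_bind, cost_pure] <;> linarith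

theorem value_sortM (le : α → α → RealRAM R Bool) (l : List α) :
    (sortM le l).value = l.mergeSort fun a b => (le a b).value := by
  fun_induction sortM le l with
  | case1 => simp
  | case2 x => simp
  | case3 x y l ih₁ ih₂ =>
    simp only [value_bind, ih₁, ih₂, value_mergeM]
    conv_rhs => rw [List.mergeSort]
    simp [List.MergeSort.Internal.splitInTwo_fst, List.MergeSort.Internal.splitInTwo_snd]

/-- Merge sort takes `O(j)` steps per element for a list of at most `2 ^ j` elements. -/
theorem cost_sortM_le (le : α → α → RealRAM R Bool) (c : ℕ) (h : ∀ a b, (le a b).cost ≤ c)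
    (j : ℕ) (l : List α) (hl : l.length ≤ 2 ^ j) :
    (sortM le l).cost ≤ (c + 3) * l.length * j + 1 := by
  induction j generalizing l with
  | zero =>
    match l, hl with
    | [], _ => simp [sortM]
    | [x], _ => simp [sortM]
  | succ j ih =>
    match l, hl with
    | [], _ => simp [sortM]
    | [x], _ => simp [sortM]
    | x :: y :: l, hl =>
      rw [sortM]
      simp only [cost_bind, cost_stepsM]
      generalize hL : x :: y :: l = L at *
      have h2 : 2 ≤ L.length := by simp [← hL]
      rw [pow_succ] at hl
      have hlen₁ : (L.take ((L.length + 1) / 2)).length = (L.length + 1) / 2 := by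
        rw [List.length_take]; omega
      have hlen₂ : (L.drop ((L.length + 1) / 2)).length = L.length - (L.length + 1) / 2 := by
        rw [List.length_drop]
      have h₁ := ih (L.take ((L.length + 1) / 2)) (by omega)
      have h₂ := ih (L.drop ((L.length + 1) / 2)) (by omega)
      have h₃ := cost_mergeM_le le c h (sortM le (L.take ((L.length + 1) / 2))).value
        (sortM le (L.drop ((L.length + 1) / 2))).value
      have hs : (L.take ((L.length + 1) / 2)).length + (L.drop ((L.length + 1) / 2)).length =
          L.length := by omega
      simp only [value_sortM, List.length_mergeSort] at h₃ ⊢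
      rw [hs] at h₃
      calc _ ≤ L.length + ((c + 3) * (L.take ((L.length + 1) / 2)).length * j + 1 +
            ((c + 3) * (L.drop ((L.length + 1) / 2)).length * j + 1 +
            ((c + 1) * L.length + 1))) := by omega
        _ = (c + 3) * ((L.take ((L.length + 1) / 2)).length +
            (L.drop ((L.length + 1) / 2)).length) * j + (c + 2) * L.length + 3 := by ring
        _ ≤ _ := by rw [hs]; nlinarith

end RealRAM

/-! ### Walks and their weights -/

/-- The weight of the first `m` edges of the walk `p 0 → p 1 → …` with respect to a matrix of edge
weights, in which `⊤` stands for a missing edge. -/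
def walkWeight {V : Type} (W : V → V → WithTop ℝ) (p : ℕ → V) (m : ℕ) : WithTop ℝ :=
  ∑ i ∈ Finset.range m, W (p i) (p (i + 1))

section Walks

variable {V : Type} {W : V → V → WithTop ℝ}

@[simp] theorem walkWeight_zero (p : ℕ → V) : walkWeight W p 0 = 0 := by simp [walkWeight]

theorem walkWeight_add (p : ℕ → V) (a b : ℕ) :
    walkWeight W p (a + b) = walkWeight W p a + walkWeight W (fun s => p (a + s)) b := by
  simp [walkWeight, Finset.sum_range_add, Nat.add_assoc]

theorem walkWeight_congr {p q : ℕ → V} {m : ℕ} (h : ∀ i ≤ m, p i = q i) :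
    walkWeight W p m = walkWeight W q m := by
  refine Finset.sum_congr rfl fun i hi => ?_
  have := Finset.mem_range.1 hi
  rw [h i (by omega), h (i + 1) (by omega)]

theorem exists_walk_edge (u v : V) :
    ∃ p : ℕ → V, p 0 = u ∧ p 1 = v ∧ walkWeight W p 1 = W u v :=
  ⟨fun s => if s = 0 then u else v, by simp, by simp, by simp [walkWeight]⟩

theorem exists_walk_concat (p q : ℕ → V) (a b : ℕ) (h : p a = q 0) :
    ∃ r : ℕ → V, r 0 = p 0 ∧ r (a + b) = q b ∧
      walkWeight W r (a + b) = walkWeight W p a + walkWeight W q b := by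
  have h₁ : ∀ i ≤ a, (if i ≤ a then p i else q (i - a)) = p i := fun i hi => by simp [hi]
  have h₂ : ∀ i, (if a + i ≤ a then p (a + i) else q (a + i - a)) = q i := fun i => by
    rcases Nat.eq_zero_or_pos i with rfl | hi
    · simp [h]
    · rw [if_neg (by omega)]; simp
  refine ⟨fun s => if s ≤ a then p s else q (s - a), h₁ 0 (by omega), h₂ b, ?_⟩
  rw [walkWeight_add, walkWeight_congr h₁]
  simp only [h₂]

/-- A walk that visits a vertex twice splits into a closed walk and a walk with the same ends. -/
theorem exists_walk_excise (p : ℕ → V) {i j m : ℕ} (hij : i < j) (hjm : j ≤ m) (h : p i = p j) :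
    ∃ r : ℕ → V, r 0 = p 0 ∧ r (m - (j - i)) = p m ∧
      walkWeight W p m = walkWeight W (fun s => p (i + s)) (j - i) +
        walkWeight W r (m - (j - i)) := by
  obtain ⟨r, h₀, h₁, h₂⟩ := exists_walk_concat (W := W) p (fun s => p (j + s)) i (m - j) h
  have e : i + (m - j) = m - (j - i) := by omega
  rw [e] at h₁ h₂
  refine ⟨r, h₀, by rw [h₁]; congr 1; omega, ?_⟩
  rw [h₂, show m = i + ((j - i) + (m - j)) by omega, walkWeight_add, walkWeight_add,
    show i + (j - i + (m - j)) - j = m - j by omega]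
  simp only [← Nat.add_assoc, show i + (j - i) = j by omega]
  exact add_left_comm _ _ _

/-- The min-plus square of a matrix. -/
def minPlusSq [Fintype V] (M : V → V → WithTop ℝ) (u v : V) : WithTop ℝ :=
  Finset.univ.inf fun w => M u w + M w v

/-- The edge weights, completed by zeros on the diagonal. -/
def zeroDiag [DecidableEq V] (W : V → V → WithTop ℝ) (u v : V) : WithTop ℝ :=
  if u = v then 0 else W u v

variable [Fintype V] [DecidableEq V]

theorem iterate_minPlusSq_le_walkWeight (hW : ∀ v, W v v = ⊤) (i : ℕ) (p : ℕ → V) (m : ℕ)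
    (hm : m ≤ 2 ^ i) : minPlusSq^[i] (zeroDiag W) (p 0) (p m) ≤ walkWeight W p m := by
  induction i generalizing p m with
  | zero =>
    obtain rfl | rfl : m = 0 ∨ m = 1 := by simp at hm; omega
    · simp [zeroDiag]
    · by_cases h : p 0 = p 1
      · simp [walkWeight, h, hW]
      · simp [walkWeight, zeroDiag, h]
  | succ i ih =>
    rw [Function.iterate_succ_apply']
    rw [pow_succ] at hm
    have h₁ := ih p (m / 2) (by omega)
    have h₂ := ih (fun s => p (m / 2 + s)) (m - m / 2) (by omega)
    have e : m / 2 + (m - m / 2) = m := by omega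
    simp only [e, Nat.add_zero] at h₂
    refine (Finset.inf_le (Finset.mem_univ (p (m / 2)))).trans ((add_le_add h₁ h₂).trans ?_)
    rw [← walkWeight_add, e]

theorem exists_walkWeight_le_iterate_minPlusSq (i : ℕ) (u v : V) :
    ∃ (p : ℕ → V) (m : ℕ), p 0 = u ∧ p m = v ∧
      walkWeight W p m ≤ minPlusSq^[i] (zeroDiag W) u v := by
  induction i generalizing u v with
  | zero =>
    by_cases h : u = v
    · exact ⟨fun _ => u, 0, rfl, h, by simp [zeroDiag, h]⟩
    · obtain ⟨p, h₀, h₁, h₂⟩ := exists_walk_edge (W := W) u v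
      exact ⟨p, 1, h₀, h₁, by simp [h₂, zeroDiag, h]⟩
  | succ i ih =>
    rw [Function.iterate_succ_apply']
    obtain ⟨w, -, hw⟩ := Finset.exists_mem_eq_inf Finset.univ ⟨u, Finset.mem_univ u⟩
      fun w => minPlusSq^[i] (zeroDiag W) u w + minPlusSq^[i] (zeroDiag W) w v
    obtain ⟨p, a, hp₀, hp₁, hp₂⟩ := ih u w
    obtain ⟨q, b, hq₀, hq₁, hq₂⟩ := ih w v
    obtain ⟨r, hr₀, hr₁, hr₂⟩ := exists_walk_concat (W := W) p q a b (hp₁.trans hq₀.symm)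
    refine ⟨r, a + b, hr₀.trans hp₀, hr₁.trans hq₁, ?_⟩
    rw [hr₂, minPlusSq, hw]
    exact add_le_add hp₂ hq₂

end Walks

/-! ### Negative cycles and negative closed walks -/

/-- The value at `t` of an optional line; a missing line stands for the constant `+∞`. -/
def lineVal : Option (Line ℝ) → ℝ → WithTop ℝ
  | none, _ => ⊤
  | some l, t => (l.eval t : ℝ)

namespace LambdaGraph

variable {n : ℕ} (G : LambdaGraph n)

/-- The matrix of the edge weights for the parameter value `t`. -/
def weight (t : ℝ) (u v : Fin n) : WithTop ℝ := lineVal (G.edge u v) t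

variable {G} {t : ℝ}

theorem weight_self (v : Fin n) : G.weight t v v = ⊤ := by simp [weight, G.loopless, lineVal]

theorem HasNegCycle.mono {s : ℝ} (h : G.HasNegCycle t) (hst : s ≤ t) : G.HasNegCycle s := by
  obtain ⟨k, c, l, hc, hl, hs⟩ := h
  refine ⟨k, c, l, hc, hl, lt_of_le_of_lt (Finset.sum_le_sum fun i _ => ?_) hs⟩
  exact add_le_add_left (mul_le_mul_of_nonneg_right hst (G.slope_nonneg _ _ _ (hl i))) _

theorem HasNegCycle.exists_walk (h : G.HasNegCycle t) :
    ∃ (p : ℕ → Fin n) (m : ℕ), m ≤ n ∧ p m = p 0 ∧ walkWeight (G.weight t) p m < 0 := by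
  obtain ⟨k, c, l, hc, hl, hs⟩ := h
  -- Going around the cycle forever is a walk.
  refine ⟨fun s => c (Fin.ofNat (k + 1) s), k + 1, ?_, by simp [Fin.ofNat], ?_⟩
  · simpa using Fintype.card_le_of_injective c hc
  · have e : ∀ i : Fin (k + 1), G.weight t (c i) (c (i + 1)) = ((l i).eval t : ℝ) := fun i => by
      simp [weight, hl, lineVal]
    rw [walkWeight, Finset.sum_range]
    have hnext : ∀ i : Fin (k + 1), Fin.ofNat (k + 1) ((i : ℕ) + 1) = i + 1 := fun i => by
      ext; simp [Fin.ofNat, Fin.val_add]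
    simp only [hnext, Fin.ofNat_val_eq_self, e]
    exact_mod_cast hs

/-- A closed walk without repeated vertices is a cycle. Its edges exist because its weight is
finite. -/
theorem hasNegCycle_of_injOn {p : ℕ → Fin n} {m : ℕ} (hp : Set.InjOn p (Set.Iio m))
    (hm : p m = p 0) (h : walkWeight (G.weight t) p m < 0) : G.HasNegCycle t := by
  obtain _ | k := m
  · simp at h
  have hnext : ∀ i : Fin (k + 1), p ((i + 1 : Fin (k + 1)) : ℕ) = p (i + 1) := fun i => by
    rw [Fin.val_add_one]
    split_ifs with hi
    · rw [hi, Fin.val_last, hm]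
    · rfl
  rw [walkWeight, Finset.sum_range] at h
  have hedge : ∀ i : Fin (k + 1), ∃ l, G.edge (p i) (p (i + 1 : Fin (k + 1))) = some l :=
      fun i => by
    rw [hnext, ← Option.ne_none_iff_exists']
    intro hi
    have : (∑ i : Fin (k + 1), G.weight t (p i) (p (i + 1))) = ⊤ :=
      WithTop.sum_eq_top.2 ⟨i, Finset.mem_univ i, by simp [weight, hi, lineVal]⟩
    simp [this] at h
  choose l hl using hedge
  refine ⟨k, fun i => p i, l, fun i j hij => Fin.ext (hp i.2 j.2 hij), hl, ?_⟩
  have e : ∀ i : Fin (k + 1), G.weight t (p i) (p (i + 1)) = ((l i).eval t : ℝ) := fun i => by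
    rw [← hnext, weight, hl, lineVal]
  simp only [e] at h
  exact_mod_cast h

/-- A closed walk that is not a simple cycle splits into two shorter closed walks. -/
theorem walkWeight_nonneg_of_closed (hG : ¬ G.HasNegCycle t) (m : ℕ) (p : ℕ → Fin n)
    (hp : p m = p 0) : 0 ≤ walkWeight (G.weight t) p m := by
  induction m using Nat.strong_induction_on generalizing p with
  | _ m ih =>
    by_cases hinj : Set.InjOn p (Set.Iio m)
    · exact not_lt.1 fun h => hG (hasNegCycle_of_injOn hinj hp h)
    · obtain ⟨i, j, hij, hjm, h⟩ : ∃ i j, i < j ∧ j < m ∧ p i = p j := by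
        simp only [Set.InjOn, Set.mem_Iio, not_forall] at hinj
        obtain ⟨i, hi, j, hj, h, hne⟩ := hinj
        rcases lt_or_gt_of_ne hne with hlt | hlt
        exacts [⟨i, j, hlt, hj, h⟩, ⟨j, i, hlt, hi, h.symm⟩]
      obtain ⟨r, h₀, h₁, h₂⟩ := exists_walk_excise (W := G.weight t) p hij hjm.le h
      rw [h₂]
      refine add_nonneg (ih _ (by omega) _ ?_) (ih _ (by omega) r (by rw [h₀, h₁, hp]))
      simp [show i + (j - i) = j by omega, h]

/-- Without negative cycles, a walk of at least `n` edges can be shortened. -/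
theorem exists_shorter_walk (hG : ¬ G.HasNegCycle t) (p : ℕ → Fin n) (m : ℕ) (hm : n ≤ m) :
    ∃ (q : ℕ → Fin n) (m' : ℕ), m' < m ∧ q m' = p m ∧
      walkWeight (G.weight t) q m' ≤ walkWeight (G.weight t) p m := by
  obtain ⟨i, j, hij, h⟩ : ∃ i j : Fin (m + 1), i < j ∧ p i = p j := by
    obtain ⟨i, j, hne, h⟩ := Fintype.exists_ne_map_eq_of_card_lt (fun i : Fin (m + 1) => p i)
      (by simp; omega)
    rcases lt_or_gt_of_ne hne with hlt | hlt
    exacts [⟨i, j, hlt, h⟩, ⟨j, i, hlt, h.symm⟩]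
  have hij' : (i : ℕ) < j := hij
  have hj := j.2
  obtain ⟨r, -, h₁, h₂⟩ := exists_walk_excise (W := G.weight t) p hij' (Nat.lt_succ_iff.1 hj) h
  refine ⟨r, m - (j - i), by omega, h₁, ?_⟩
  rw [h₂]
  refine le_add_of_nonneg_left (walkWeight_nonneg_of_closed hG _ _ ?_)
  simp [show (i : ℕ) + (j - i) = j by omega, h]

/-- Negative cycles show up as negative diagonal entries of an iterated min-plus square, because a
simple cycle has at most `n` edges. -/
theorem hasNegCycle_iff_iterate_minPlusSq {k : ℕ} (hk : n ≤ 2 ^ k) :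
    G.HasNegCycle t ↔ ∃ v, minPlusSq^[k] (zeroDiag (G.weight t)) v v < 0 := by
  refine ⟨fun h => ?_, fun ⟨v, hv⟩ => ?_⟩
  · obtain ⟨p, m, hm, hp, hneg⟩ := h.exists_walk
    refine ⟨p 0, lt_of_le_of_lt ?_ hneg⟩
    simpa [hp] using iterate_minPlusSq_le_walkWeight (fun v => weight_self v) k p m (hm.trans hk)
  · obtain ⟨p, m, h₀, h₁, hle⟩ := exists_walkWeight_le_iterate_minPlusSq (W := G.weight t) k v v
    by_contra hG
    exact absurd (walkWeight_nonneg_of_closed hG m p (h₁.trans h₀.symm))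
      (not_le.2 (hle.trans_lt hv))

end LambdaGraph

/-! ### Bellman–Ford -/

namespace LambdaStar

open RealRAM

/-- The number `d v` is the minimum weight of the walks of at most `k` edges that end at `v`,
wherever they start. -/
structure IsWalkMin {n : ℕ} (W : Fin n → Fin n → WithTop ℝ) (k : ℕ) (d : Fin n → ℝ) : Prop where
  le : ∀ (p : ℕ → Fin n) (m : ℕ), m ≤ k → (d (p m) : WithTop ℝ) ≤ walkWeight W p m
  exists_le : ∀ v, ∃ (p : ℕ → Fin n) (m : ℕ), m ≤ k ∧ p m = v ∧
    walkWeight W p m ≤ (d v : WithTop ℝ)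

/-- A round of relaxations admits one more edge. -/
theorem IsWalkMin.relax {n : ℕ} {W : Fin n → Fin n → WithTop ℝ} {k : ℕ} {d d' : Fin n → ℝ}
    (hd : IsWalkMin W k d)
    (h : ∀ (v : Fin n) (c : ℝ), c ≤ d' v ↔ c ≤ d v ∧ ∀ u, (c : WithTop ℝ) ≤ d u + W u v) :
    IsWalkMin W (k + 1) d' where
  le p m hm := by
    have h' := (h (p m) (d' (p m))).1 le_rfl
    rcases Nat.lt_or_ge k m with hk | hk
    · obtain rfl : m = k + 1 := by omega
      refine (h'.2 (p k)).trans ?_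
      rw [walkWeight_add]
      refine add_le_add (hd.le p k le_rfl) ?_
      simp [walkWeight]
    · exact le_trans (by exact_mod_cast h'.1) (hd.le p m hk)
  exists_le v := by
    by_contra! hno
    -- If no walk attains the value, then some larger `c` still bounds all the terms.
    have key : ∃ c : ℝ, d' v < c ∧ c ≤ d v ∧ ∀ u, (c : WithTop ℝ) ≤ d u + W u v := by
      have hlt : ∀ u, (d' v : WithTop ℝ) < d u + W u v := fun u => by
        obtain ⟨p, m, hm, hp, hle⟩ := hd.exists_le u
        obtain ⟨q, hq₀, hq₁, hq₂⟩ := exists_walk_edge (W := W) u v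
        obtain ⟨r, -, hr₁, hr₂⟩ := exists_walk_concat (W := W) p q m 1 (hp.trans hq₀.symm)
        have := hno r (m + 1) (by omega) (hr₁.trans hq₁)
        rw [hr₂, hq₂] at this
        exact this.trans_le (add_le_add_left hle _)
      have hlt₀ : d' v < d v := by
        obtain ⟨p, m, hm, hp, hle⟩ := hd.exists_le v
        exact_mod_cast (hno p m (by omega) hp).trans_le hle
      have hinf : (d' v : WithTop ℝ) <
          min (d v : WithTop ℝ) (Finset.univ.inf fun u => (d u : WithTop ℝ) + W u v) := by
        rw [lt_min_iff, Finset.lt_inf_iff (WithTop.coe_lt_top _)]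
        exact ⟨by exact_mod_cast hlt₀, fun u _ => hlt u⟩
      have hne : min (d v : WithTop ℝ)
          (Finset.univ.inf fun u => (d u : WithTop ℝ) + W u v) ≠ ⊤ :=
        ((min_le_left _ _).trans_lt (WithTop.coe_lt_top _)).ne
      obtain ⟨c, hc⟩ := WithTop.ne_top_iff_exists.1 hne
      rw [← hc] at hinf
      refine ⟨c, by exact_mod_cast hinf, ?_, fun u => ?_⟩
      · exact_mod_cast hc.le.trans (min_le_left _ _)
      · exact hc.le.trans ((min_le_right _ _).trans (Finset.inf_le (Finset.mem_univ u)))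
    obtain ⟨c, hc, hc'⟩ := key
    exact absurd ((h v c).2 hc') (not_le.2 hc)

/-- There is a negative cycle if and only if an edge can still be relaxed after `n` rounds: without
negative cycles, a walk of `n + 1` edges can be shortened. -/
theorem IsWalkMin.hasNegCycle_iff {n : ℕ} {G : LambdaGraph n} {t : ℝ} {d : Fin n → ℝ}
    (hd : IsWalkMin (G.weight t) n d) :
    G.HasNegCycle t ↔ ∃ u v, (d u : WithTop ℝ) + G.weight t u v < d v := by
  refine ⟨fun h => ?_, fun ⟨u, v, huv⟩ => ?_⟩
  · by_contra! hno
    -- `d` is a feasible potential, so that the weights of closed walks telescope.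
    obtain ⟨p, m, -, hp, hneg⟩ := h.exists_walk
    have : ∀ m, (d (p m) : WithTop ℝ) ≤ d (p 0) + walkWeight (G.weight t) p m := fun m => by
      induction m with
      | zero => simp
      | succ m ih =>
        refine (hno (p m) (p (m + 1))).trans ?_
        rw [walkWeight_add, ← add_assoc]
        refine add_le_add ih ?_
        simp [walkWeight]
    have hm := this m
    rw [hp] at hm
    refine absurd hm (not_le.2 ?_)
    obtain ⟨x, hx⟩ := WithTop.ne_top_iff_exists.1 (hneg.trans (WithTop.coe_lt_top 0)).ne
    rw [← hx] at hneg ⊢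
    have : x < 0 := by exact_mod_cast hneg
    exact_mod_cast (by linarith : d (p 0) + x < d (p 0))
  · by_contra hG
    obtain ⟨p, m, hm, hp, hle⟩ := hd.exists_le u
    obtain ⟨q, hq₀, hq₁, hq₂⟩ := exists_walk_edge (W := G.weight t) u v
    obtain ⟨r, -, hr₁, hr₂⟩ := exists_walk_concat (W := G.weight t) p q m 1 (hp.trans hq₀.symm)
    have hlt : walkWeight (G.weight t) r (m + 1) < d v := by
      rw [hr₂, hq₂]
      exact (add_le_add_left hle _).trans_lt huv
    obtain ⟨s, m', hm', hs, hle'⟩ : ∃ (s : ℕ → Fin n) (m' : ℕ), m' ≤ n ∧ s m' = v ∧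
        walkWeight (G.weight t) s m' ≤ walkWeight (G.weight t) r (m + 1) := by
      rcases Nat.lt_or_ge m n with hlt | hge
      · exact ⟨r, m + 1, hlt, hr₁.trans hq₁, le_rfl⟩
      · obtain ⟨s, m', h₁, h₂, h₃⟩ := G.exists_shorter_walk hG r (m + 1) (by omega)
        exact ⟨s, m', by omega, h₂.trans (hr₁.trans hq₁), h₃⟩
    have := hd.le s m' hm'
    rw [hs] at this
    exact absurd (this.trans hle') (not_le.2 hlt)

/-- The loop invariant is that after `k` rounds the array satisfies `IsWalkMin` with `k`. -/
theorem value_bellmanFord {n : ℕ} (G : LambdaGraph n) (t : ℝ) :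
    (bellmanFord G.edge t).value = true ↔ G.HasNegCycle t := by
  obtain ⟨W, hW, hWt⟩ : ∃ W : Fin n → Fin n → Option ℝ,
      (W = fun u v => (G.edge u v).map fun l => l.eval t) ∧
      ∀ u v, G.weight t u v = (W u v).elim ⊤ fun x => (x : WithTop ℝ) := by
    refine ⟨_, rfl, fun u v => ?_⟩
    cases h : G.edge u v <;> simp [LambdaGraph.weight, h, lineVal]
  unfold bellmanFord
  rw [value_bind]
  generalize hM : (tabulate₂ (R := ℝ) (α := Option ℝ) n _).value = M
  obtain rfl : M = W := by
    rw [← hM, value_tabulate₂]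
    funext u v
    cases h : G.edge u v <;> simp [hW, h, Line.eval]
  rw [value_bind, value_bind]
  simp only [value_tabulate, value_zeroM]
  generalize hdef : (iter (R := ℝ) _ n fun _ : Fin n => (0 : ℝ)).value = d
  have hd : IsWalkMin (G.weight t) n d := by
    rw [← hdef]
    refine value_iter_induct _ (fun k d => IsWalkMin (G.weight t) k d)
      (fun k d hd => ?_) n _ ?_
    · refine hd.relax fun v c => ?_
      rw [value_tabulate]
      beta_reduce
      rw [value_bind, value_readM]
      rw [value_loop_iff _ (fun best : ℝ => c ≤ best)
        (fun u => (c : WithTop ℝ) ≤ d u + G.weight t u v)]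
      · simp
      · intro best u
        rw [hWt]
        cases h : M u v with
        | none => simp [h]
        | some w =>
          simp only [value_bind, value_readM₂, h, value_readM, value_addM, value_ltM,
            Option.elim_some, ← WithTop.coe_add, WithTop.coe_le_coe, decide_eq_true_eq]
          split_ifs with hlt
          · simp only [value_pure]
            exact ⟨fun hc => ⟨hc.trans hlt.le, hc⟩, And.right⟩
          · simp only [value_pure]
            exact ⟨fun hc => ⟨hc, hc.trans (not_lt.1 hlt)⟩, And.left⟩
    · refine ⟨fun p m hm => ?_, fun v => ⟨fun _ => v, 0, le_rfl, rfl, by simp⟩⟩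
      obtain rfl : m = 0 := by omega
      simp
  rw [hd.hasNegCycle_iff, ← not_iff_not, Bool.not_eq_true]
  rw [value_loop_iff _ (fun found => found = false)
    (fun u => ∀ v, ¬ (d u : WithTop ℝ) + G.weight t u v < d v)]
  · simp
  · intro found u
    rw [value_loop_iff _ (fun found => found = false)
      (fun v => ¬ (d u : WithTop ℝ) + G.weight t u v < d v)]
    · simp
    · intro found v
      rw [hWt]
      cases h : M u v with
      | none => simp [h]
      | some w =>
        simp only [value_bind, value_readM₂, h, value_readM, value_addM, value_ltM,
          Option.elim_some, ← WithTop.coe_add, WithTop.coe_lt_coe, decide_eq_true_eq]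
        split_ifs with hlt <;> simp [hlt]

end LambdaStar

/-! ### Extended values and lower envelopes -/

/-- The extended value, as an extended real number. -/
noncomputable def ExtVal.toEReal : ExtVal ℝ → EReal
  | .negInf => ⊥
  | .fin x => x
  | .posInf => ⊤

namespace RealRAM

@[simp] theorem value_extLtM (a b : ExtVal ℝ) :
    (extLtM a b).value = true ↔ a.toEReal < b.toEReal := by
  cases a <;> cases b <;> simp [extLtM, ExtVal.toEReal]

end RealRAM

namespace LambdaStar

open RealRAM

open Classical in
/-- The value at `t` of a piecewise linear function: that of its first piece that starts at `t` or
before. -/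
noncomputable def plVal : PLFun ℝ → ℝ → WithTop ℝ
  | [], _ => ⊤
  | p :: ps, t => if p.start.toEReal ≤ t then (p.line.eval t : ℝ) else plVal ps t

/-- A list of pieces such that each piece, together with those to its left, describes the minimum
of their lines. Moreover, there is no jump at a breakpoint. -/
inductive IsEnvelope : PLFun ℝ → Prop
  | nil : IsEnvelope []
  | cons (p : Piece ℝ) (ps : PLFun ℝ)
      (right : ∀ t : ℝ, p.start.toEReal ≤ t → (p.line.eval t : WithTop ℝ) ≤ plVal ps t)
      (left : ∀ t : ℝ, t ≤ p.start.toEReal → plVal ps t ≤ (p.line.eval t : WithTop ℝ)) :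
      IsEnvelope ps → IsEnvelope (p :: ps)

theorem IsEnvelope.plVal_cons {p : Piece ℝ} {ps : PLFun ℝ} (h : IsEnvelope (p :: ps)) (t : ℝ) :
    plVal (p :: ps) t = min (p.line.eval t : WithTop ℝ) (plVal ps t) := by
  cases h with
  | cons _ _ right left h =>
    rw [plVal]
    split_ifs with ht
    · exact (min_eq_left (right t ht)).symm
    · exact (min_eq_right (left t (not_le.1 ht).le)).symm

theorem IsEnvelope.plVal_le {ps : PLFun ℝ} (h : IsEnvelope ps) (t : ℝ) {p : Piece ℝ} (hp : p ∈ ps) :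
    plVal ps t ≤ (p.line.eval t : WithTop ℝ) := by
  induction h with
  | nil => simp at hp
  | cons q qs right left h ih =>
    rw [(IsEnvelope.cons q qs right left h).plVal_cons]
    rcases List.mem_cons.1 hp with rfl | hp
    · exact min_le_left _ _
    · exact (min_le_right _ _).trans (ih hp)

/-- The order of the lines in the construction of a lower envelope: by decreasing slope, then by
increasing intercept. -/
def lineLe (a b : Line ℝ) : Prop := b.slope < a.slope ∨ a.slope = b.slope ∧ a.icept ≤ b.icept

theorem value_lineLeM (a b : Line ℝ) : (lineLeM a b).value = true ↔ lineLe a b := by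
  unfold lineLeM lineLe
  simp only [value_bind, value_ltM, decide_eq_true_eq, value_ite]
  split_ifs with h₁ h₂
  · simp [h₁]
  · simp [h₁, h₂.ne]
  · simp [le_antisymm (not_lt.1 h₁) (not_lt.1 h₂)]

theorem cost_lineLeM_le (a b : Line ℝ) : (lineLeM a b).cost ≤ 3 := by
  unfold lineLeM
  simp only [cost_bind, value_ltM, cost_ltM, cost_ite, cost_pure, decide_eq_true_eq]
  split_ifs <;> simp

/-- Pushing a line onto the envelope of lines that precede it in the order `lineLe` forms the
pointwise minimum. A line of the same slope lies below the new one; otherwise the two lines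
intersect at `x`, and the last piece is superfluous if it starts at `x` or later. -/
theorem value_pushLine (l : Line ℝ) (ps : PLFun ℝ) (hps : IsEnvelope ps)
    (hl : ∀ p ∈ ps, lineLe p.line l) :
    IsEnvelope (pushLine l ps).value ∧
      ∀ t, plVal (pushLine l ps).value t = min (plVal ps t) (l.eval t : WithTop ℝ) := by
  induction hps with
  | nil =>
    simp only [pushLine, value_bind, value_pure]
    refine ⟨.cons _ _ (fun t _ => le_top) (fun t ht => ?_) .nil, fun t => ?_⟩
    · simp [ExtVal.toEReal] at ht
    · simp [plVal, ExtVal.toEReal]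
  | cons p ps right left h ih =>
    have hE := IsEnvelope.cons p ps right left h
    have hp := hl p (by simp)
    simp only [pushLine, value_bind, value_ltM, decide_eq_true_eq, value_subM, value_divM,
      value_extLtM, value_ite]
    split_ifs with hs hx
    · simp only [value_pure]
      set x := (l.icept - p.line.icept) / (p.line.slope - l.slope) with hxdef
      have hpos : 0 < p.line.slope - l.slope := sub_pos.2 hs
      have hxmul : x * (p.line.slope - l.slope) = l.icept - p.line.icept :=
        div_mul_cancel₀ _ hpos.ne'
      have hright : ∀ t : ℝ, x ≤ t → l.eval t ≤ p.line.eval t := fun t ht => by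
        have := mul_le_mul_of_nonneg_right ht hpos.le
        simp only [Line.eval]; linarith
      have hleft : ∀ t : ℝ, t ≤ x → p.line.eval t ≤ l.eval t := fun t ht => by
        have := mul_le_mul_of_nonneg_right ht hpos.le
        simp only [Line.eval]; linarith
      have hE' : IsEnvelope (⟨.fin x, l⟩ :: p :: ps) := by
        refine .cons _ _ (fun t ht => ?_) (fun t ht => ?_) hE
        · rw [plVal, if_pos (hx.le.trans ht)]
          exact_mod_cast hright t (by simpa [ExtVal.toEReal] using ht)
        · refine (hE.plVal_le t (List.mem_cons_self)).trans ?_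
          exact_mod_cast hleft t (by simpa [ExtVal.toEReal] using ht)
      exact ⟨hE', fun t => by rw [hE'.plVal_cons, min_comm]⟩
    · obtain ⟨h₁, h₂⟩ := ih fun q hq => hl q (by simp [hq])
      refine ⟨h₁, fun t => ?_⟩
      rw [h₂, hE.plVal_cons]
      set x := (l.icept - p.line.icept) / (p.line.slope - l.slope) with hxdef
      have hpos : 0 < p.line.slope - l.slope := sub_pos.2 hs
      have hxmul : x * (p.line.slope - l.slope) = l.icept - p.line.icept :=
        div_mul_cancel₀ _ hpos.ne'
      rcases le_total p.start.toEReal (t : EReal) with ht | ht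
      · have hxt : x ≤ t := by
          simpa [ExtVal.toEReal] using (not_lt.1 hx).trans ht
        have hlt : l.eval t ≤ p.line.eval t := by
          have := mul_le_mul_of_nonneg_right hxt hpos.le
          simp only [Line.eval]; linarith
        have hlt' : (l.eval t : WithTop ℝ) ≤ p.line.eval t := by exact_mod_cast hlt
        rw [min_eq_left (right t ht), min_eq_right (hlt'.trans (right t ht)), min_eq_right hlt']
      · rw [min_eq_right (left t ht)]
    · refine ⟨by simpa using hE, fun t => ?_⟩
      simp only [value_pure]
      refine (min_eq_left ((hE.plVal_le t (List.mem_cons_self)).trans ?_)).symm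
      obtain hp | ⟨h₁, h₂⟩ := hp
      · exact absurd hp hs
      · exact_mod_cast (by simp only [Line.eval, h₁]; linarith : p.line.eval t ≤ l.eval t)

theorem mem_value_pushLine {l : Line ℝ} {ps : PLFun ℝ} {q : Piece ℝ}
    (hq : q ∈ (pushLine l ps).value) : q.line = l ∨ q ∈ ps := by
  induction ps with
  | nil => simp [pushLine] at hq; simp [hq]
  | cons p ps ih =>
    simp only [pushLine, value_bind, value_ite] at hq
    split_ifs at hq
    · simp only [value_pure, List.mem_cons] at hq ⊢
      obtain rfl | hq := hq
      exacts [Or.inl rfl, Or.inr hq]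
    · exact (ih hq).imp_right (List.mem_cons_of_mem _)
    · exact Or.inr hq

theorem length_value_pushLine_le (l : Line ℝ) (ps : PLFun ℝ) :
    (pushLine l ps).value.length ≤ 1 + ps.length := by
  induction ps with
  | nil => simp [pushLine]
  | cons p ps ih =>
    simp only [pushLine, value_bind, value_ite]
    split_ifs <;> simp only [value_pure, List.length_cons] <;> omega

/-- Amortized running time: removing a piece is paid for by the potential of that piece. -/
theorem cost_pushLine_add_le (l : Line ℝ) (ps : PLFun ℝ) :
    (pushLine l ps).cost + 7 * (pushLine l ps).value.length ≤ 14 + 7 * ps.length := by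
  induction ps with
  | nil => simp [pushLine]
  | cons p ps ih =>
    have h := cost_extLtM_le p.start
      (.fin ((l.icept - p.line.icept) / (p.line.slope - l.slope)))
    simp only [pushLine, cost_bind, cost_stepM, cost_ltM, value_bind, cost_ite, value_ite,
      cost_subM, cost_divM, value_subM, value_divM, cost_pure, value_pure]
    split_ifs <;> simp only [List.length_cons] <;> omega

/-- Pushing sorted lines one after the other. -/
theorem value_loop_pushLine (ls : List (Line ℝ)) (hls : ls.Pairwise lineLe) (ps : PLFun ℝ)
    (hps : IsEnvelope ps) (h : ∀ p ∈ ps, ∀ l ∈ ls, lineLe p.line l) :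
    IsEnvelope (loop (fun ps l => pushLine l ps) ps ls).value ∧
      ∀ (t : ℝ) (c : WithTop ℝ), c ≤ plVal (loop (fun ps l => pushLine l ps) ps ls).value t ↔
        c ≤ plVal ps t ∧ ∀ l ∈ ls, c ≤ (l.eval t : WithTop ℝ) := by
  induction ls generalizing ps with
  | nil => simpa [loop] using hps
  | cons l ls ih =>
    rw [List.pairwise_cons] at hls
    obtain ⟨h₁, h₂⟩ := value_pushLine l ps hps fun p hp => h p hp l (by simp)
    have := ih hls.2 (pushLine l ps).value h₁ fun p hp l' hl' => by
      rcases mem_value_pushLine hp with rfl | hp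
      · exact hls.1 l' hl'
      · exact h p hp l' (by simp [hl'])
    simpa [loop, h₂, and_assoc] using this

theorem value_lowerEnvelope (ls : List (Line ℝ)) :
    IsEnvelope (lowerEnvelope ls).value ∧
      ∀ (t : ℝ) (c : WithTop ℝ), c ≤ plVal (lowerEnvelope ls).value t ↔
        ∀ l ∈ ls, c ≤ (l.eval t : WithTop ℝ) := by
  have hs : (sortM lineLeM ls).value.Pairwise lineLe := by
    rw [value_sortM]
    refine (List.pairwise_mergeSort ?_ ?_ ls).imp fun h => (value_lineLeM _ _).1 h
    · intro a b c
      simp only [value_lineLeM, lineLe]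
      rintro (h₁ | ⟨h₁, h₁'⟩) (h₂ | ⟨h₂, h₂'⟩)
      · exact Or.inl (h₂.trans h₁)
      · exact Or.inl (h₂ ▸ h₁)
      · exact Or.inl (h₁ ▸ h₂)
      · exact Or.inr ⟨h₁.trans h₂, h₁'.trans h₂'⟩
    · intro a b
      rw [Bool.or_eq_true, value_lineLeM, value_lineLeM]
      unfold lineLe
      rcases lt_trichotomy a.slope b.slope with h | h | h
      · exact Or.inr (Or.inl h)
      · exact (le_total a.icept b.icept).imp (fun h' => Or.inr ⟨h, h'⟩)
          fun h' => Or.inr ⟨h.symm, h'⟩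
      · exact Or.inl (Or.inl h)
  have := value_loop_pushLine _ hs [] .nil (by simp)
  rw [lowerEnvelope, value_bind]
  refine ⟨this.1, fun t c => ?_⟩
  rw [this.2]
  simp [plVal, value_sortM]

theorem mem_value_lowerEnvelope {ls : List (Line ℝ)} {p : Piece ℝ}
    (hp : p ∈ (lowerEnvelope ls).value) : p.line ∈ ls := by
  have key : ∀ (ls : List (Line ℝ)) (ps : PLFun ℝ),
      p ∈ (loop (fun ps l => pushLine l ps) ps ls).value → p.line ∈ ls ∨ p ∈ ps := by
    intro ls
    induction ls with
    | nil => intro ps hp; exact Or.inr hp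
    | cons l ls ih =>
      intro ps hp
      rw [loop, value_bind, value_bind] at hp
      rcases ih _ hp with h | h
      · exact Or.inl (by simp [h])
      · exact (mem_value_pushLine h).imp_left fun h => by simp [h]
  rw [lowerEnvelope, value_bind] at hp
  simpa [value_sortM] using key _ _ hp

theorem length_value_lowerEnvelope_le (ls : List (Line ℝ)) :
    (lowerEnvelope ls).value.length ≤ ls.length := by
  have := length_value_loop_le (R := ℝ) (fun ps l => pushLine l ps) 1 (sortM lineLeM ls).value
    (fun ps l _ => length_value_pushLine_le l ps) []
  rw [lowerEnvelope, value_bind]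
  simpa [value_sortM] using this

theorem cost_lowerEnvelope_le (ls : List (Line ℝ)) (j : ℕ) (h : ls.length ≤ 2 ^ j) :
    (lowerEnvelope ls).cost ≤ 6 * ls.length * j + 15 * ls.length + 1 := by
  have h₁ := cost_sortM_le lineLeM 3 cost_lineLeM_le j ls h
  have h₂ := cost_loop_add_le (R := ℝ) (fun ps l => pushLine l ps) (fun ps => 7 * ps.length) 14
    (sortM lineLeM ls).value (fun ps l _ => cost_pushLine_add_le l ps) []
  rw [lowerEnvelope, cost_bind]
  simp only [value_sortM, List.length_mergeSort, List.length_nil] at h₂ ⊢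
  linarith

end LambdaStar

/-! ### The steps of a round -/

namespace LambdaStar

open RealRAM

section MinPlus

variable {n : ℕ} (D : Fin n → Fin n → Option (Line ℝ)) (u v : Fin n)

theorem isEnvelope_minPlusEntry : IsEnvelope (minPlusEntry D u v).value := by
  rw [minPlusEntry, value_bind]
  exact (value_lowerEnvelope _).1

theorem plVal_minPlusEntry (t : ℝ) :
    plVal (minPlusEntry D u v).value t = minPlusSq (fun u v => lineVal (D u v) t) u v := by
  refine eq_of_forall_le_iff fun c => ?_
  rw [minPlusEntry, value_bind, (value_lowerEnvelope _).2, minPlusSq, Finset.le_inf_iff]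
  rw [value_loop_iff _ (fun acc : List (Line ℝ) => ∀ l ∈ acc, c ≤ (l.eval t : WithTop ℝ))
    (fun w => c ≤ lineVal (D u w) t + lineVal (D w v) t)]
  · simp
  · intro acc w
    cases h₁ : D u w with
    | none => simp [h₁, lineVal]
    | some a =>
      cases h₂ : D w v with
      | none => simp [h₁, h₂, lineVal]
      | some b =>
        have e : (⟨a.slope + b.slope, a.icept + b.icept⟩ : Line ℝ).eval t =
            a.eval t + b.eval t := by simp only [Line.eval]; ring
        simp only [value_bind, value_readM₂, h₁, h₂, value_addM, value_pure, List.forall_mem_cons,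
          e, lineVal, WithTop.coe_add]
        exact and_comm

theorem slope_nonneg_of_mem_minPlusEntry (hD : ∀ u v, ∀ l ∈ D u v, 0 ≤ l.slope) {p : Piece ℝ}
    (hp : p ∈ (minPlusEntry D u v).value) : 0 ≤ p.line.slope := by
  rw [minPlusEntry, value_bind] at hp
  refine (value_loop_iff _ (fun acc : List (Line ℝ) => ∀ l ∈ acc, 0 ≤ l.slope)
    (fun w => ∀ a ∈ D u w, ∀ b ∈ D w v, 0 ≤ a.slope + b.slope) ?_ [] (List.finRange n)).2 ?_ _
    (mem_value_lowerEnvelope hp)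
  · intro acc w
    cases h₁ : D u w with
    | none => simp [h₁]
    | some a =>
      cases h₂ : D w v with
      | none => simp [h₁, h₂]
      | some b => simp [h₁, h₂, and_comm]
  · exact ⟨by simp, fun w _ a ha b hb => add_nonneg (hD _ _ a ha) (hD _ _ b hb)⟩

theorem length_minPlusEntry_le : (minPlusEntry D u v).value.length ≤ n := by
  rw [minPlusEntry, value_bind]
  refine (length_value_lowerEnvelope_le _).trans
    ((length_value_loop_le _ 1 _ (fun acc w _ => ?_) _).trans (by simp))
  cases h₁ : D u w with
  | none => simp [h₁]
  | some a => cases h₂ : D w v <;> simp [h₁, h₂, Nat.add_comm]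

theorem cost_minPlusEntry_le (k : ℕ) (hk : n ≤ 2 ^ k) :
    (minPlusEntry D u v).cost ≤ 6 * n * k + 20 * n + 1 := by
  rw [minPlusEntry, cost_bind]
  generalize hf : (fun (acc : List (Line ℝ)) w => _) = f
  have hcost : (loop (R := ℝ) f [] (List.finRange n)).cost ≤ n * 5 := by
    refine (cost_loop_le f 4 _ (fun acc w _ => ?_) _).trans (by simp)
    rw [← hf]
    cases h₁ : D u w with
    | none => simp [h₁]
    | some a => cases h₂ : D w v <;> simp [h₁, h₂]
  have hlen : (loop (R := ℝ) f [] (List.finRange n)).value.length ≤ n := by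
    refine (length_value_loop_le f 1 _ (fun acc w _ => ?_) _).trans (by simp)
    rw [← hf]
    cases h₁ : D u w with
    | none => simp [h₁]
    | some a => cases h₂ : D w v <;> simp [h₁, h₂, Nat.add_comm]
  have h := cost_lowerEnvelope_le _ k (hlen.trans hk)
  have h' := Nat.mul_le_mul_right (6 * k + 15) hlen
  linarith

end MinPlus

/-- In a sorted list, an element that is not less than the next one equals it. -/
theorem value_dedupSorted (l : List ℝ) (hl : l.Pairwise (· ≤ ·)) :
    (dedupSorted l).value.Sublist l ∧ ∀ x, x ∈ (dedupSorted l).value ↔ x ∈ l := by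
  fun_induction dedupSorted l with
  | case1 => simp
  | case2 x => simp
  | case3 x y l ih =>
    rw [List.pairwise_cons] at hl
    obtain ⟨h₁, h₂⟩ := ih hl.2
    simp only [value_bind, value_ltM, decide_eq_true_eq, value_ite, value_pure]
    split_ifs with h
    · exact ⟨h₁.cons_cons x, fun z => by simp [h₂]⟩
    · obtain rfl : x = y := le_antisymm (hl.1 y (by simp)) (not_lt.1 h)
      exact ⟨h₁.cons x, fun z => by rw [h₂]; simp⟩

theorem cost_dedupSorted_le (l : List ℝ) : (dedupSorted l).cost ≤ 2 * l.length + 1 := by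
  fun_induction dedupSorted l with
  | case1 => simp
  | case2 x => simp
  | case3 x y l ih =>
    simp only [cost_bind, cost_stepM, cost_ltM, cost_ite, cost_pure, List.length_cons] at ih ⊢
    split_ifs <;> omega

theorem pairwise_le_value_sortM (l : List ℝ) :
    (sortM (R := ℝ) (fun x y => do let r ← ltM y x; return !r) l).value.Pairwise (· ≤ ·) := by
  rw [value_sortM]
  refine (List.pairwise_mergeSort ?_ ?_ _).imp fun h => by simpa using h
  · intro a b c; simpa using le_trans
  · intro a b; simpa using le_total a b

/-- The breakpoints are sorted, and they are the finite starting points of pieces strictly between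
`lo` and `hi`. -/
theorem value_breakpoints {n : ℕ} (E : Fin n → Fin n → PLFun ℝ) (lo hi : ExtVal ℝ) :
    (breakpoints E lo hi).value.Pairwise (· ≤ ·) ∧
      ∀ x : ℝ, x ∈ (breakpoints E lo hi).value ↔
        (lo.toEReal < x ∧ x < hi.toEReal) ∧ ∃ u v, ∃ p ∈ E u v, p.start = .fin x := by
  rw [breakpoints, value_bind, value_bind]
  generalize hf : (fun (B : List ℝ) (u : Fin n) => _) = f
  have hmem : ∀ x : ℝ, x ∈ (loop (R := ℝ) f [] (List.finRange n)).value ↔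
      (lo.toEReal < x ∧ x < hi.toEReal) ∧ ∃ u v, ∃ p ∈ E u v, p.start = .fin x := fun x => by
    have := value_loop_iff f (fun B => x ∉ B)
      (fun u => ∀ v, ∀ p ∈ E u v, ¬ ((lo.toEReal < x ∧ x < hi.toEReal) ∧ p.start = .fin x)) ?_ []
      (List.finRange n)
    · rw [← not_iff_not, this]
      simp only [List.not_mem_nil, not_false_eq_true, List.mem_finRange, forall_const, true_and,
        not_and, not_exists]
      exact ⟨fun h hx u v p hp => h u v p hp hx, fun h u v p hp hx => h hx u v p hp⟩
    · intro B u
      rw [← hf, value_loop_iff _ (fun B => x ∉ B) (fun v => ∀ p ∈ E u v,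
        ¬ ((lo.toEReal < x ∧ x < hi.toEReal) ∧ p.start = .fin x))]
      · simp
      · intro B v
        rw [value_bind, value_readM₂, value_loop_iff _ (fun B => x ∉ B) (fun p =>
          ¬ ((lo.toEReal < x ∧ x < hi.toEReal) ∧ p.start = .fin x))]
        intro B p
        cases h : p.start with
        | negInf => simp
        | posInf => simp
        | fin y =>
          simp only [value_bind, value_ite, value_extLtM, value_pure]
          by_cases hyx : y = x
          · subst hyx
            have e : (ExtVal.fin y).toEReal = y := rfl
            rw [e]
            split_ifs with h₁ h₂ <;> simp [*]
          · have hxy : x ≠ y := Ne.symm hyx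
            split_ifs <;> simp [hyx, hxy]
  have hsort := pairwise_le_value_sortM (loop (R := ℝ) f [] (List.finRange n)).value
  obtain ⟨h₁, h₂⟩ := value_dedupSorted _ hsort
  refine ⟨hsort.sublist h₁, fun x => ?_⟩
  rw [h₂, ← hmem, value_sortM, List.mem_mergeSort]

theorem cost_breakpoints_le {n : ℕ} (E : Fin n → Fin n → PLFun ℝ) (lo hi : ExtVal ℝ)
    (hE : ∀ u v, (E u v).length ≤ n) (k : ℕ) (hk : n ≤ 2 ^ k) :
    (breakpoints E lo hi).value.length ≤ n ^ 3 ∧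
      (breakpoints E lo hi).cost ≤ 12 * n ^ 3 * k + 7 * n ^ 3 + 2 * n ^ 2 + n + 2 := by
  rw [breakpoints, value_bind, value_bind, cost_bind, cost_bind]
  generalize hf : (fun (B : List ℝ) (u : Fin n) => _) = f
  have hlen : (loop (R := ℝ) f [] (List.finRange n)).value.length ≤ n ^ 3 := by
    refine (length_value_loop_le f (n * (n * 1)) _ (fun B u _ => ?_) _).trans ?_
    · rw [← hf]
      refine (length_value_loop_le _ (n * 1) _ (fun B v _ => ?_) _).trans (by simp)
      rw [value_bind, value_readM₂]
      refine (length_value_loop_le _ 1 _ (fun B p _ => ?_) _).trans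
        (by simpa using hE u v)
      cases h : p.start with
      | negInf => simp
      | posInf => simp
      | fin y =>
        simp only [value_bind, value_ite, value_pure]
        split_ifs <;> simp [Nat.add_comm]
    · simp; exact le_of_eq (by ring)
  have hcost : (loop (R := ℝ) f [] (List.finRange n)).cost ≤
      n * (n * (1 + n * 5 + 1) + 1) := by
    refine (cost_loop_le f _ _ (fun B u _ => ?_) _).trans (by rw [List.length_finRange])
    rw [← hf]
    refine (cost_loop_le _ _ _ (fun B v _ => ?_) _).trans (by rw [List.length_finRange])
    rw [cost_bind, cost_readM₂, value_readM₂]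
    refine Nat.add_le_add_left ((cost_loop_le _ 4 _ (fun B p _ => ?_) _).trans
      (Nat.mul_le_mul_right _ (hE u v))) _
    cases h : p.start with
    | negInf => simp
    | posInf => simp
    | fin y =>
      have h₁ := cost_extLtM_le lo (.fin y)
      have h₂ := cost_extLtM_le (.fin y) hi
      simp only [cost_bind, cost_ite, cost_pure, ite_self]
      split_ifs <;> omega
  have hsort := cost_sortM_le (R := ℝ) (fun x y => do let r ← ltM y x; return !r) 1
    (fun a b => by simp) (3 * k) (loop (R := ℝ) f [] (List.finRange n)).value
    (hlen.trans (by rw [Nat.mul_comm, pow_mul]; exact Nat.pow_le_pow_left hk 3))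
  have hdedup := cost_dedupSorted_le (sortM (R := ℝ) (fun x y => do let r ← ltM y x; return !r)
    (loop f [] (List.finRange n)).value).value
  have hsub := (value_dedupSorted _ (pairwise_le_value_sortM
    (loop (R := ℝ) f [] (List.finRange n)).value)).1.length_le
  rw [value_sortM, List.length_mergeSort] at hdedup hsub
  refine ⟨by rw [value_sortM]; exact hsub.trans hlen, ?_⟩
  rw [value_sortM]
  have h := Nat.mul_le_mul_right (12 * k + 2) hlen
  linarith

end LambdaStar

/-! ### Locating `λ*` among the breakpoints -/

namespace LambdaStar

open RealRAM

theorem cost_bellmanFord_le {n : ℕ} (edge : Fin n → Fin n → Option (Line ℝ)) (t : ℝ) :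
    (bellmanFord edge t).cost ≤ 22 * n ^ 3 := by
  have key : (bellmanFord edge t).cost ≤ n * (n * (3 + 1) + 1) + (n * (1 + 1) +
      (n * (n * (1 + n * (4 + 1) + 1) + 1) + n * (n * (5 + 1) + 1))) := by
    rw [bellmanFord, cost_bind]
    generalize (tabulate₂ (R := ℝ) (α := Option ℝ) n _).value = W
    rw [cost_bind, cost_bind]
    generalize (iter (R := ℝ) (σ := Fin n → ℝ) _ n _).value = d
    refine Nat.add_le_add (cost_tabulate₂_le n _ 3 fun u v => ?_) (Nat.add_le_add
      (cost_tabulate_le n _ 1 fun _ => le_rfl) (Nat.add_le_add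
      (cost_iter_le _ _ (fun d => cost_tabulate_le n _ _ fun v => ?_) _ _)
      ((cost_loop_le _ _ _ (fun found u _ => (cost_loop_le _ 5 _ (fun found v _ => ?_) _).trans
        (by rw [List.length_finRange])) _).trans (by rw [List.length_finRange]))))
    · cases h : edge u v <;> simp [h]
    · rw [cost_bind, cost_readM, value_readM]
      refine Nat.add_le_add_left ((cost_loop_le _ 4 _ (fun best u _ => ?_) _).trans
        (by rw [List.length_finRange])) _
      cases h : W u v <;> simp [h, cost_ite]
    · cases h : W u v <;> simp [h, cost_ite]
  have h₁ : n ≤ n ^ 3 := Nat.le_self_pow (by norm_num) n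
  have h₂ : n ^ 2 ≤ n ^ 3 := by
    rcases Nat.eq_zero_or_pos n with rfl | hn
    · simp
    · exact Nat.pow_le_pow_right hn (by norm_num)
  linarith

/-- All parameter values up to `lo` have a negative cycle, and no value from `hi` on has one.
The condition `hi_ne` excludes the empty bracket whose right end is `-∞`. -/
structure IsBracket {n : ℕ} (G : LambdaGraph n) (lo hi : ExtVal ℝ) : Prop where
  neg : ∀ t : ℝ, (t : EReal) ≤ lo.toEReal → G.HasNegCycle t
  not_neg : ∀ t : ℝ, hi.toEReal ≤ t → ¬ G.HasNegCycle t
  hi_ne : hi.toEReal ≠ ⊥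

/-- The search returns a bracket inside the given one, with no element of `B` in its interior. -/
theorem value_binarySearch {n : ℕ} (G : LambdaGraph n) (lo hi : ExtVal ℝ) (B : List ℝ)
    (hB : B.Pairwise (· ≤ ·)) (hlo : ∀ x ∈ B, lo.toEReal ≤ (x : EReal))
    (hhi : ∀ x ∈ B, (x : EReal) ≤ hi.toEReal) (h : IsBracket G lo hi) :
    ∃ lo' hi', (binarySearch G.edge lo hi B).value = (lo', hi') ∧ IsBracket G lo' hi' ∧
      lo.toEReal ≤ lo'.toEReal ∧ hi'.toEReal ≤ hi.toEReal ∧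
      ∀ x ∈ B, (x : EReal) ≤ lo'.toEReal ∨ hi'.toEReal ≤ (x : EReal) := by
  induction hN : B.length using Nat.strong_induction_on generalizing lo hi B with
  | _ N ih =>
  subst hN
  rcases B with _ | ⟨x, B⟩
  · exact ⟨lo, hi, by simp [binarySearch], h, le_rfl, le_rfl, by simp⟩
  · simp only [binarySearch, value_bind, value_ite]
    have hpos : 0 < (x :: B).length := by simp
    have hmL : (x :: B).length / 2 < (x :: B).length := by omega
    generalize hT : (x :: B).get ⟨(x :: B).length / 2, hmL⟩ = test
    have hsplit : x :: B = (x :: B).take ((x :: B).length / 2) ++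
        test :: (x :: B).drop ((x :: B).length / 2 + 1) := by
      rw [← hT]; simp only [List.get_eq_getElem, List.cons_getElem_drop_succ, List.take_append_drop]
    clear hT
    generalize x :: B = L at *
    set m := L.length / 2 with hm
    have ih₁ := ih (L.drop (m + 1)).length
      (by rw [List.length_drop]; omega) (.fin test) hi (L.drop (m + 1))
    have ih₂ := ih (L.take m).length
      (by rw [List.length_take]; omega) lo (.fin test) (L.take m)
    have hmem : ∀ y, y ∈ L ↔ y ∈ L.take m ∨ y = test ∨ y ∈ L.drop (m + 1) := fun y => by
      conv_lhs => rw [hsplit]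
      simp
    have hB' := hB
    rw [hsplit, List.pairwise_append, List.pairwise_cons] at hB'
    obtain ⟨hB₁, ⟨hr, hB₂⟩, hl⟩ := hB'
    have hl' : ∀ y ∈ L.take m, y ≤ test := fun y hy => hl y hy test (by simp)
    have e : (ExtVal.fin test).toEReal = (test : EReal) := rfl
    split_ifs with hneg <;> rw [value_bellmanFord] at hneg
    · obtain ⟨lo', hi', h₁, h₂, h₃, h₄, h₅⟩ := ih₁ hB₂
        (fun y hy => by rw [e]; exact_mod_cast hr y hy)
        (fun y hy => hhi y ((hmem y).2 (Or.inr (Or.inr hy))))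
        ⟨fun t ht => hneg.mono (by rw [e] at ht; exact_mod_cast ht), h.not_neg, h.hi_ne⟩ rfl
      rw [e] at h₃
      refine ⟨lo', hi', h₁, h₂, (hlo test ((hmem test).2 (Or.inr (Or.inl rfl)))).trans h₃, h₄,
        fun y hy => ?_⟩
      rcases (hmem y).1 hy with hy | rfl | hy
      · exact Or.inl (le_trans (by exact_mod_cast hl' y hy) h₃)
      · exact Or.inl h₃
      · exact h₅ y hy
    · obtain ⟨lo', hi', h₁, h₂, h₃, h₄, h₅⟩ := ih₂ hB₁
        (fun y hy => hlo y ((hmem y).2 (Or.inl hy)))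
        (fun y hy => by rw [e]; exact_mod_cast hl' y hy)
        ⟨h.neg, fun t ht ht' => hneg (ht'.mono (by rw [e] at ht; exact_mod_cast ht)),
          EReal.coe_ne_bot _⟩ rfl
      rw [e] at h₄
      refine ⟨lo', hi', h₁, h₂, h₃, h₄.trans (hhi test ((hmem test).2 (Or.inr (Or.inl rfl)))),
        fun y hy => ?_⟩
      rcases (hmem y).1 hy with hy | rfl | hy
      · exact h₅ y hy
      · exact Or.inr h₄
      · exact Or.inr (h₄.trans (by exact_mod_cast hr y hy))

/-- Taking lists apart costs `2 * B.length` in total, because the lengths are halved. -/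
theorem cost_binarySearch_le {n : ℕ} (edge : Fin n → Fin n → Option (Line ℝ)) (lo hi : ExtVal ℝ)
    (j : ℕ) (B : List ℝ) (hB : B.length < 2 ^ j) :
    (binarySearch edge lo hi B).cost ≤ 2 * B.length + 1 + 22 * n ^ 3 * j := by
  induction j generalizing lo hi B with
  | zero =>
    obtain rfl : B = [] := by simpa using hB
    simp [binarySearch]
  | succ j ih =>
    rcases B with _ | ⟨x, B⟩
    · simp [binarySearch]
    · rw [binarySearch]
      rw [cost_bind, cost_stepsM, cost_bind, cost_ite]
      have hpos : 0 < (x :: B).length := by simp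
      generalize (x :: B).get ⟨(x :: B).length / 2, Nat.div_lt_self hpos one_lt_two⟩ = test
      generalize x :: B = L at *
      rw [pow_succ] at hB
      have h₀ := cost_bellmanFord_le edge test
      have h₁ := ih (.fin test) hi (L.drop (L.length / 2 + 1)) (by rw [List.length_drop]; omega)
      have h₂ := ih lo (.fin test) (L.take (L.length / 2)) (by rw [List.length_take]; omega)
      rw [List.length_drop] at h₁
      rw [List.length_take] at h₂
      rw [Nat.mul_succ]
      split_ifs <;> omega

/-- If no breakpoint lies strictly between `lo` and `hi`, the first piece that starts at `lo` or
before is valid on the whole interval, at `hi` too because there are no jumps. -/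
theorem value_simplify (lo : ExtVal ℝ) (hi : EReal) (ps : PLFun ℝ) (hps : IsEnvelope ps)
    (h : ∀ p ∈ ps, p.start.toEReal ≤ lo.toEReal ∨ hi ≤ p.start.toEReal) (t : ℝ)
    (hlo : lo.toEReal ≤ t) (hhi : t ≤ hi) : lineVal (simplify lo ps).value t = plVal ps t := by
  induction hps with
  | nil => simp [simplify, lineVal, plVal]
  | cons p ps right left hps ih =>
    simp only [simplify, value_bind, value_ite, value_extLtM, value_pure]
    split_ifs with hp
    · have hstart := hhi.trans ((h p (by simp)).resolve_left (not_le.2 hp))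
      rw [ih fun q hq => h q (by simp [hq]), plVal]
      split_ifs with ht
      · exact le_antisymm (left t hstart) (right t ht)
      · rfl
    · rw [lineVal, plVal, if_pos ((not_lt.1 hp).trans hlo)]

theorem exists_mem_of_mem_simplify {lo : ExtVal ℝ} {ps : PLFun ℝ} {l : Line ℝ}
    (hl : l ∈ (simplify lo ps).value) : ∃ p ∈ ps, p.line = l := by
  induction ps with
  | nil => simp [simplify] at hl
  | cons p ps ih =>
    simp only [simplify, value_bind, value_ite, value_extLtM, value_pure] at hl
    split_ifs at hl
    · obtain ⟨q, hq, e⟩ := ih hl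
      exact ⟨q, by simp [hq], e⟩
    · exact ⟨p, by simp, by simpa using hl⟩

theorem cost_simplify_le (lo : ExtVal ℝ) (ps : PLFun ℝ) :
    (simplify lo ps).cost ≤ 3 * ps.length + 1 := by
  induction ps with
  | nil => simp [simplify]
  | cons p ps ih =>
    have h := cost_extLtM_le lo p.start
    simp only [simplify, cost_bind, cost_stepM, cost_ite, cost_pure, List.length_cons]
    split_ifs <;> omega

/-! ### The main loop -/

/-- The loop invariant: `λ*` lies between `λ₁` and `λ₂`, and there the matrix `D` describes the
minimum weights of walks with at most `2 ^ i` edges. -/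
structure LoopInvariant {n : ℕ} (G : LambdaGraph n) (i : ℕ) (s : Vars ℝ n) : Prop where
  bracket : IsBracket G s.lo s.hi
  lineVal_eq : ∀ t : ℝ, s.lo.toEReal ≤ t → t ≤ s.hi.toEReal →
    (fun u v => lineVal (s.D u v) t) = minPlusSq^[i] (zeroDiag (G.weight t))
  slope_nonneg : ∀ u v, ∀ l ∈ s.D u v, 0 ≤ l.slope

theorem loopInvariant_initialMatrix {n : ℕ} (G : LambdaGraph n) :
    LoopInvariant G 0 ⟨.negInf, .posInf, (initialMatrix G.edge).value⟩ := by
  have hD : ∀ u v, (initialMatrix G.edge).value u v =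
      if u = v then some ⟨0, 0⟩ else G.edge u v := fun u v => by
    rw [initialMatrix, value_tabulate₂]
    simp only [value_bind, value_ite, value_zeroM, value_pure, value_readM₂]
  refine ⟨⟨fun t ht => ?_, fun t ht => ?_, ?_⟩, fun t _ _ => ?_, fun u v l hl => ?_⟩
  · simp [ExtVal.toEReal] at ht
  · simp [ExtVal.toEReal] at ht
  · simp [ExtVal.toEReal]
  · funext u v
    simp only [hD, Function.iterate_zero, id_eq, zeroDiag, LambdaGraph.weight]
    split_ifs <;> simp [lineVal, Line.eval]
  · simp only [hD] at hl
    split_ifs at hl with h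
    · obtain rfl : _ = l := by simpa using hl
      exact le_rfl
    · exact G.slope_nonneg u v l hl

theorem cost_initialMatrix_le {n : ℕ} (edge : Fin n → Fin n → Option (Line ℝ)) :
    (initialMatrix edge).cost ≤ n * (n * (2 + 1) + 1) := by
  refine cost_tabulate₂_le n _ 2 fun u v => ?_
  simp only [cost_bind, cost_stepM, cost_ite, cost_zeroM, cost_pure, cost_readM₂]
  split_ifs <;> omega

theorem LoopInvariant.round {n : ℕ} {G : LambdaGraph n} {i : ℕ} {s : Vars ℝ n}
    (hs : LoopInvariant G i s) : LoopInvariant G (i + 1) (round G.edge s).value := by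
  simp only [LambdaStar.round, value_bind, value_tabulate₂, value_readM₂, value_pure]
  set E := fun u v => (minPlusEntry s.D u v).value with hE
  obtain ⟨hB, hmem⟩ := value_breakpoints E s.lo s.hi
  obtain ⟨lo', hi', hval, hbr, hlo, hhi, hsep⟩ := value_binarySearch G s.lo s.hi _ hB
    (fun x hx => ((hmem x).1 hx).1.1.le) (fun x hx => ((hmem x).1 hx).1.2.le) hs.bracket
  rw [hval]
  refine ⟨hbr, fun t ht₁ ht₂ => ?_, fun u v l hl => ?_⟩
  · simp only at ht₁ ht₂ ⊢
    rw [Function.iterate_succ_apply', ← hs.lineVal_eq t (hlo.trans ht₁) (ht₂.trans hhi)]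
    funext u v
    rw [value_simplify lo' hi'.toEReal _ (isEnvelope_minPlusEntry s.D u v) _ t ht₁ ht₂,
      plVal_minPlusEntry]
    -- A breakpoint inside the new interval would have been among the sorted ones.
    intro p hp
    cases h : p.start with
    | negInf => exact Or.inl bot_le
    | posInf => exact Or.inr le_top
    | fin x =>
      by_contra! hx
      have hxB : x ∈ (breakpoints E s.lo s.hi).value :=
        (hmem x).2 ⟨⟨hlo.trans_lt hx.1, hx.2.trans_le hhi⟩, u, v, p, hp, h⟩
      rcases hsep x hxB with h' | h'
      · exact not_lt.2 h' hx.1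
      · exact not_lt.2 h' hx.2
  · obtain ⟨p, hp, rfl⟩ := exists_mem_of_mem_simplify hl
    exact slope_nonneg_of_mem_minPlusEntry s.D u v hs.slope_nonneg hp

theorem cost_round_le {n : ℕ} (edge : Fin n → Fin n → Option (Line ℝ)) (s : Vars ℝ n) (k : ℕ)
    (hk : n ≤ 2 ^ k) : (LambdaStar.round edge s).cost ≤ 84 * n ^ 3 * k + 70 * n ^ 3 + 3 := by
  simp only [LambdaStar.round, cost_bind, value_tabulate₂, value_bind, cost_pure]
  set E := fun u v => (minPlusEntry s.D u v).value with hE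
  have hlenE : ∀ u v, (E u v).length ≤ n := fun u v => length_minPlusEntry_le s.D u v
  have h₁ := cost_tabulate₂_le n (fun u v => minPlusEntry s.D u v) _
    fun u v => cost_minPlusEntry_le s.D u v k hk
  obtain ⟨hlen, h₂⟩ := cost_breakpoints_le E s.lo s.hi hlenE k hk
  have hlt : (breakpoints E s.lo s.hi).value.length < 2 ^ (3 * k + 1) := by
    refine hlen.trans_lt ((Nat.pow_le_pow_left hk 3).trans_lt ?_)
    rw [← pow_mul, Nat.mul_comm]
    exact Nat.pow_lt_pow_right (by norm_num) (by omega)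
  have h₃ := cost_binarySearch_le edge s.lo s.hi _ _ hlt
  have h₄ : ∀ lo : ExtVal ℝ, (tabulate₂ (R := ℝ) n fun u v => do
      let ps ← readM₂ E u v
      simplify lo ps).cost ≤ n * (n * (1 + (3 * n + 1) + 1) + 1) := fun lo =>
    cost_tabulate₂_le n _ _ fun u v => by
      rw [cost_bind, cost_readM₂, value_readM₂]
      exact Nat.add_le_add_left ((cost_simplify_le _ _).trans
        (by have := hlenE u v; omega)) _
  have h₅ := h₄ (binarySearch edge s.lo s.hi (breakpoints E s.lo s.hi).value).value.1
  have hn₁ : n ≤ n ^ 3 := Nat.le_self_pow (by norm_num) n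
  have hn₂ : n ^ 2 ≤ n ^ 3 := by
    rcases Nat.eq_zero_or_pos n with rfl | hn
    · simp
    · exact Nat.pow_le_pow_right hn (by norm_num)
  linarith

/-! ### The returned value -/

/-- A nondecreasing line is nonnegative at `t` if and only if its zero, or `±∞` for a constant line,
is at most `t`. -/
theorem toEReal_value_finalValue_le_iff {n : ℕ} (lo : ExtVal ℝ)
    (D : Fin n → Fin n → Option (Line ℝ)) (hD : ∀ u v, ∀ l ∈ D u v, 0 ≤ l.slope) (t : ℝ) :
    (finalValue lo D).value.toEReal ≤ t ↔
      lo.toEReal ≤ t ∧ ∀ v, (0 : WithTop ℝ) ≤ lineVal (D v v) t := by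
  rw [finalValue, value_bind, value_zeroM]
  rw [value_loop_iff _ (fun best : ExtVal ℝ => best.toEReal ≤ t)
    (fun v => (0 : WithTop ℝ) ≤ lineVal (D v v) t)]
  · simp
  · intro best v
    cases h : D v v with
    | none => simp [h, lineVal]
    | some l =>
      have hl := hD v v l h
      simp only [value_bind, value_readM₂, h, value_ite, value_ltM, decide_eq_true_eq,
        value_subM, value_divM, value_extLtM, value_pure, lineVal, WithTop.coe_nonneg, Line.eval]
      split_ifs with h₁ h₂ h₃
      · have hx : (ExtVal.fin ((0 - l.icept) / l.slope)).toEReal ≤ t ↔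
            0 ≤ t * l.slope + l.icept := by
          simp only [ExtVal.toEReal, EReal.coe_le_coe_iff, div_le_iff₀ h₁]
          constructor <;> intro h <;> linarith
        rw [← hx]
        exact ⟨fun h => ⟨h₂.le.trans h, h⟩, And.right⟩
      · have hx : (ExtVal.fin ((0 - l.icept) / l.slope)).toEReal ≤ t ↔
            0 ≤ t * l.slope + l.icept := by
          simp only [ExtVal.toEReal, EReal.coe_le_coe_iff, div_le_iff₀ h₁]
          constructor <;> intro h <;> linarith
        rw [← hx]
        exact ⟨fun h => ⟨h, (not_lt.1 h₂).trans h⟩, And.left⟩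
      · have h₀ : l.slope = 0 := le_antisymm (not_lt.1 h₁) hl
        simp [ExtVal.toEReal, h₀, h₃]
      · have h₀ : l.slope = 0 := le_antisymm (not_lt.1 h₁) hl
        simp [h₀, not_lt.1 h₃]

theorem cost_finalValue_le {n : ℕ} (lo : ExtVal ℝ) (D : Fin n → Fin n → Option (Line ℝ)) :
    (finalValue lo D).cost ≤ 1 + n * (6 + 1) := by
  rw [finalValue, cost_bind, cost_zeroM]
  refine Nat.add_le_add_left ((cost_loop_le _ 6 _ (fun best v _ => ?_) _).trans
    (by rw [List.length_finRange])) _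
  cases h : D v v with
  | none => simp [h]
  | some l =>
    have hc := cost_extLtM_le best (.fin ((0 - l.icept) / l.slope))
    simp only [cost_bind, value_zeroM, cost_readM₂, value_readM₂, h, cost_ite, cost_ltM,
      value_ltM, decide_eq_true_eq, cost_subM, value_subM, cost_divM, value_divM, cost_pure,
      ite_self]
    split_ifs <;> omega

/-- The returned value separates the parameter values with negative cycles from those without. -/
theorem toEReal_value_algorithm_le_iff {n : ℕ} (G : LambdaGraph n) (t : ℝ) :
    (algorithm G.edge).value.toEReal ≤ t ↔ ¬ G.HasNegCycle t := by
  rw [algorithm, value_bind, value_bind]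
  have hinv := value_iter_induct (LambdaStar.round G.edge) (LoopInvariant G)
    (fun i s hs => hs.round) (Nat.clog 2 n) _ (loopInvariant_initialMatrix G)
  set s := (iter (LambdaStar.round G.edge) (Nat.clog 2 n)
    ⟨.negInf, .posInf, (initialMatrix G.edge).value⟩).value with hs
  rw [toEReal_value_finalValue_le_iff _ _ hinv.slope_nonneg]
  have hin : ∀ t : ℝ, s.lo.toEReal ≤ t → t ≤ s.hi.toEReal →
      (¬ G.HasNegCycle t ↔ ∀ v, (0 : WithTop ℝ) ≤ lineVal (s.D v v) t) := fun t h₁ h₂ => by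
    rw [LambdaGraph.hasNegCycle_iff_iterate_minPlusSq (Nat.le_pow_clog (by norm_num) n),
      ← hinv.lineVal_eq t h₁ h₂]
    simp
  rcases lt_or_ge (t : EReal) s.lo.toEReal with hlo | hlo
  · simp [not_le.2 hlo, hinv.bracket.neg t hlo.le]
  rcases le_or_gt (t : EReal) s.hi.toEReal with hhi | hhi
  · rw [hin t hlo hhi]
    simp [hlo]
  · -- To the right of `λ₂` the matrix is not reliable, but its diagonal is nondecreasing.
    have hnot := hinv.bracket.not_neg t hhi.le
    refine iff_of_true ⟨hlo, fun v => ?_⟩ hnot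
    obtain ⟨x, hx⟩ : ∃ x : ℝ, s.hi.toEReal = x := by
      cases h : s.hi with
      | negInf => exact absurd (by rw [h]; rfl) hinv.bracket.hi_ne
      | posInf => rw [h] at hhi; exact absurd hhi (not_lt.2 le_top)
      | fin x => exact ⟨x, rfl⟩
    have hxlo : s.lo.toEReal ≤ x := by
      by_contra! hlt
      exact hinv.bracket.not_neg x hx.le (hinv.bracket.neg x hlt.le)
    have h := (hin x hxlo hx.ge).1 (hinv.bracket.not_neg x hx.le) v
    have hxt : x ≤ t := by rw [hx] at hhi; exact_mod_cast hhi.le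
    cases hD : s.D v v with
    | none => exact le_top
    | some l =>
      rw [hD] at h
      have hmono := mul_le_mul_of_nonneg_right hxt (hinv.slope_nonneg v v l hD)
      simp only [lineVal, WithTop.coe_nonneg, Line.eval] at h ⊢
      linarith

theorem cost_algorithm_le {n : ℕ} (edge : Fin n → Fin n → Option (Line ℝ)) (hn : 2 ≤ n) :
    (algorithm edge).cost ≤ 170 * (n ^ 3 * Nat.clog 2 n ^ 2) := by
  set k := Nat.clog 2 n with hk
  have h₁ := cost_initialMatrix_le edge
  have h₂ := cost_iter_le (LambdaStar.round edge) _
    (fun s => cost_round_le edge s k (Nat.le_pow_clog (by norm_num) n)) k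
    ⟨.negInf, .posInf, (initialMatrix edge).value⟩
  have h₃ := fun s : Vars ℝ n => cost_finalValue_le s.lo s.D
  have hk₁ : 1 ≤ k := Nat.clog_pos (by norm_num) hn
  have key : (algorithm edge).cost ≤ n * (n * (2 + 1) + 1) +
      (k * (84 * n ^ 3 * k + 70 * n ^ 3 + 3 + 1) + (1 + n * (6 + 1))) := by
    rw [algorithm, cost_bind, cost_bind]
    exact Nat.add_le_add h₁ (Nat.add_le_add h₂ (h₃ _))
  have hn₃ : 8 ≤ n ^ 3 := Nat.pow_le_pow_left hn 3
  have hn₁ : 4 * n ≤ n ^ 3 := by nlinarith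
  have hn₂ : 2 * n ^ 2 ≤ n ^ 3 := by nlinarith
  have hkk : k ≤ k ^ 2 := by nlinarith
  have hA : n ^ 3 ≤ n ^ 3 * k ^ 2 := Nat.le_mul_of_pos_right _ (by positivity)
  have hB : n ^ 3 * k ≤ n ^ 3 * k ^ 2 := Nat.mul_le_mul_left _ hkk
  have hC : 8 * k ≤ n ^ 3 * k := Nat.mul_le_mul_right _ hn₃
  linarith

end LambdaStar

/-! ### Correctness and running time -/

theorem mainTheorem2 :
    (∀ (n : ℕ) (G : LambdaGraph n),
      G.IsLambdaStar (LambdaStar.algorithm G.edge).value) ∧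
    ∃ C : ℝ, ∀ (n : ℕ), 2 ≤ n → ∀ G : LambdaGraph n,
      ((LambdaStar.algorithm G.edge).cost : ℝ) ≤ C * (n : ℝ) ^ 3 * (Real.log (n : ℝ)) ^ 2 := by
  refine ⟨fun n G => ?_, 170 * (2 / Real.log 2) ^ 2, fun n hn G => ?_⟩
  · have h := LambdaStar.toEReal_value_algorithm_le_iff G
    revert h
    generalize (LambdaStar.algorithm G.edge).value = r
    intro h
    cases r with
    | negInf => exact fun t => (h t).1 bot_le
    | posInf => exact fun t => not_not.1 fun ht => by simpa [ExtVal.toEReal] using (h t).2 ht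
    | fin x =>
      exact ⟨(h x).1 le_rfl, fun t ht => EReal.coe_le_coe_iff.1 ((h t).2 ht)⟩
  · have hlog2 : 0 < Real.log 2 := Real.log_pos (by norm_num)
    have hclog : (Nat.clog 2 n : ℝ) ≤ 2 / Real.log 2 * Real.log n := by
      -- `2 ^ (⌈log₂ n⌉ - 1) ≤ n`, and `1 ≤ log₂ n`.
      have h₁ : 2 ^ (Nat.clog 2 n - 1) ≤ n := (Nat.pow_pred_clog_lt_self (by norm_num) hn).le
      have h₂ : ((Nat.clog 2 n - 1 : ℕ) : ℝ) * Real.log 2 ≤ Real.log n := by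
        rw [← Real.log_pow]
        exact Real.log_le_log (by positivity) (by exact_mod_cast h₁)
      have h₃ : Real.log 2 ≤ Real.log n :=
        Real.log_le_log (by norm_num) (by exact_mod_cast hn)
      rw [Nat.cast_pred (Nat.clog_pos (by norm_num) hn)] at h₂
      rw [div_mul_eq_mul_div, le_div_iff₀ hlog2]
      linarith
    have hcost : ((LambdaStar.algorithm G.edge).cost : ℝ) ≤
        170 * ((n : ℝ) ^ 3 * (Nat.clog 2 n : ℝ) ^ 2) := by
      exact_mod_cast LambdaStar.cost_algorithm_le G.edge hn
    calc _ ≤ _ := hcost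
      _ ≤ 170 * ((n : ℝ) ^ 3 * (2 / Real.log 2 * Real.log n) ^ 2) := by gcongr
      _ = _ := by ring
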